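/- Let $\theta\in\mathbb R$ with $e^{i\theta}\neq 1$ and let $U_\theta=\mathrm{diag}(1,1,1,e^{i\theta})$ on two qubits (one held by Alice, one by Bob). An $n$-turn LOCC protocol consists of $n$ turns; at each turn one party performs a generalized measurement on its own system, given by finitely many operators $M^{(r)}$ with $\sum_r M^{(r)\dagger}M^{(r)}=\mathbb I$ (the dimension of the system may change), and announces the outcome; everything later may depend on the earlier outcomes, and after the last turn each party holds one qubit. For a sequence $R$ of outcomes of the first turns, the accumulated operators $A^{R}$, $B^{R}$ are the products of Alice's, respectively Bob's, measurement operators along $R$. Assisted by a normalized resource vector $\psi\in\mathbb C^p\otimes\mathbb C^q$ shared by Alice and Bob, the protocol (deterministically) implements $U_\theta$ if for every two-qubit input state $\rho$ $$\sum_{R}(A^{R}\otimes B^{R})(\rho\otimes|\psi\rangle\langle\psi|)(A^{R}\otimes B^{R})^\dagger=U_\theta\,\rho\,U_\theta^\dagger ,$$ where $R$ runs over the complete outcome sequences. The Schmidt number of $\psi$ is the number of nonzero coefficients of its Schmidt decomposition. (1) Let $p=q=2$, let $\psi$ have Schmidt number 2, and let an $n$-turn protocol implement $U_\theta$ with resource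 $\psi$. Let $R$ be a sequence of outcomes of the first $n-3$ turns after which the last three turns are Bob's, Alice's and Bob's, with accumulated operators $A$, $B$, and let $A_{00}=\sqrt{\langle 0|A^\dagger A|0\rangle}$ and $B_{00}=\sqrt{\langle 0|B^\dagger B|0\rangle}$, where $|0\rangle$ is the basis state of the party's input qubit; these are operators on the party's resource qubit. Say that a measurement $\{M^{(r)}\}$ acts on the range of an operator $C$ as a random unitary operation if there are probabilities $w_r$ with $\sum_r w_r=1$ and operators $V_r$ with $M^{(r)}C=\sqrt{w_r}\,V_rC$ for all $r$, where $V_r$ preserves inner products on the range of $C$ whenever $w_r\ne0$. (a) If $\operatorname{rank}A_{00}=1$, then, after every outcome of Bob's next turn for which the resulting branch has nonzero probability, Alice's measurement at turn $n-1$ acts on the range of $A$ as a random unitary operation. (b) If $\operatorname{rank}B_{00}=1$ and the branch $R$ has nonzero probability, then Bob's measurement at turn $n-2$ acts on the range of $B$ as a random unitary operation. (c) If $\operatorname{rank}A_{00}=\operatorname{rank}B_{00}=2$, then the last three turns after $R$ can be replaced by three turns performed by Alice, Bob, Alice (the first $n-3$ turns being unchanged), such that for every input state the (unnormalized) output obtained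 from the branch $R$ is the same. (2) Let $p,q$ be arbitrary, let $\psi$ have Schmidt number 2, and let an $n$-turn protocol implement $U_\theta$ with resource $\psi$. If $n>3$, then there is an $(n-1)$-turn protocol that coincides with the given one during the first $n-4$ turns and implements $U_\theta$ with the same resource $\psi$. Moreover (for every $n$) there is a three-turn protocol, with the parties acting in the order Alice, Bob, Alice or Bob, Alice, Bob, that implements $U_\theta$ with the resource $\psi$. -/

import Mathlib

open scoped Matrix Kronecker MatrixOrder ComplexOrder

namespace LOCC

inductive Party
  | alice
  | bob

/-- Two-party LOCC protocols with `n` turns in every branch, for local systems of (current)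
dimensions `a` (first party, Alice) and `b` (second party, Bob).  At each turn one party performs a
generalized measurement, given by measurement operators `M i` with `∑ i, (M i)† (M i) = 1`, and
announces the outcome `i`; everything that follows may depend on it, including who acts next.
The operators may change the dimension of the local system (ancillas, discarding).  After the last
turn each party is left with one qubit, the output.  A trivial turn is the one-outcome
measurement `1`. -/
inductive Protocol : ℕ → ℕ → ℕ → Type
  | done : Protocol 0 2 2
  | alice {n a b : ℕ} (r : ℕ) (d : Fin r → ℕ) (M : ∀ i, Matrix (Fin (d i)) (Fin a) ℂ)
      (complete : ∑ i, (M i)ᴴ * M i = 1) (next : ∀ i, Protocol n (d i) b) : Protocol (n + 1) a b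
  | bob {n a b : ℕ} (r : ℕ) (d : Fin r → ℕ) (K : ∀ i, Matrix (Fin (d i)) (Fin b) ℂ)
      (complete : ∑ i, (K i)ᴴ * K i = 1) (next : ∀ i, Protocol n a (d i)) : Protocol (n + 1) a b

/-- The completely positive trace-preserving map that a protocol performs. -/
noncomputable def Protocol.run : {n a b : ℕ} → Protocol n a b →
    Matrix (Fin a × Fin b) (Fin a × Fin b) ℂ → Matrix (Fin 2 × Fin 2) (Fin 2 × Fin 2) ℂ
  | _, _, _, .done, σ => σ
  | _, _, b, .alice _ _ M _ next, σ =>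
      ∑ i, (next i).run
        ((M i ⊗ₖ (1 : Matrix (Fin b) (Fin b) ℂ)) * σ * (M i ⊗ₖ (1 : Matrix (Fin b) (Fin b) ℂ))ᴴ)
  | _, a, _, .bob _ _ K _ next, σ =>
      ∑ i, (next i).run
        (((1 : Matrix (Fin a) (Fin a) ℂ) ⊗ₖ K i) * σ * ((1 : Matrix (Fin a) (Fin a) ℂ) ⊗ₖ K i)ᴴ)

/-- In every branch the acting parties are, in order, those of the list. -/
def Protocol.Follows : {n a b : ℕ} → Protocol n a b → List Party → Prop
  | _, _, _, .done, s => s = []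
  | _, _, _, .alice _ _ _ _ next, s => ∃ t, s = Party.alice :: t ∧ ∀ i, (next i).Follows t
  | _, _, _, .bob _ _ _ _ next, s => ∃ t, s = Party.bob :: t ∧ ∀ i, (next i).Follows t

/-- `Q.IsNode P A B`: some sequence of outcomes of the first turns of `P` leads to the remaining
protocol `Q`, and `A`, `B` are the accumulated operators (the products of the measurement operators
along that sequence) of Alice and Bob. -/
inductive Protocol.IsNode {m a' b' : ℕ} (Q : Protocol m a' b') : {n a b : ℕ} → Protocol n a b →
    Matrix (Fin a') (Fin a) ℂ → Matrix (Fin b') (Fin b) ℂ → Prop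
  | here : IsNode Q Q 1 1
  | alice {n a b r : ℕ} {d : Fin r → ℕ} {M : ∀ i, Matrix (Fin (d i)) (Fin a) ℂ}
      {complete : ∑ i, (M i)ᴴ * M i = 1} {next : ∀ i, Protocol n (d i) b} (i : Fin r)
      {A : Matrix (Fin a') (Fin (d i)) ℂ} {B : Matrix (Fin b') (Fin b) ℂ}
      (h : IsNode Q (next i) A B) : IsNode Q (Protocol.alice r d M complete next) (A * M i) B
  | bob {n a b r : ℕ} {d : Fin r → ℕ} {K : ∀ i, Matrix (Fin (d i)) (Fin b) ℂ}
      {complete : ∑ i, (K i)ᴴ * K i = 1} {next : ∀ i, Protocol n a (d i)} (i : Fin r)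
      {A : Matrix (Fin a') (Fin a) ℂ} {B : Matrix (Fin b') (Fin (d i)) ℂ}
      (h : IsNode Q (next i) A B) : IsNode Q (Protocol.bob r d K complete next) A (B * K i)

/-- The two protocols coincide during their first `k` turns. -/
inductive Protocol.SameFirst : ℕ → {n n' a b : ℕ} → Protocol n a b → Protocol n' a b → Prop
  | zero {n n' a b : ℕ} (P : Protocol n a b) (P' : Protocol n' a b) : SameFirst 0 P P'
  | alice {k n n' a b r : ℕ} {d : Fin r → ℕ} {M : ∀ i, Matrix (Fin (d i)) (Fin a) ℂ}
      {complete : ∑ i, (M i)ᴴ * M i = 1} {next : ∀ i, Protocol n (d i) b}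
      {next' : ∀ i, Protocol n' (d i) b} (h : ∀ i, SameFirst k (next i) (next' i)) :
      SameFirst (k + 1) (Protocol.alice r d M complete next) (Protocol.alice r d M complete next')
  | bob {k n n' a b r : ℕ} {d : Fin r → ℕ} {K : ∀ i, Matrix (Fin (d i)) (Fin b) ℂ}
      {complete : ∑ i, (K i)ᴴ * K i = 1} {next : ∀ i, Protocol n a (d i)}
      {next' : ∀ i, Protocol n' a (d i)} (h : ∀ i, SameFirst k (next i) (next' i)) :
      SameFirst (k + 1) (Protocol.bob r d K complete next) (Protocol.bob r d K complete next')

/-- Density matrices. -/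
def IsState {ι : Type} [Fintype ι] (ρ : Matrix ι ι ℂ) : Prop :=
  ρ.PosSemidef ∧ ρ.trace = 1

/-- `ψ` is a normalized vector of `ℂ^p ⊗ ℂ^q` whose Schmidt decomposition has exactly `r` nonzero
coefficients. -/
def IsPureStateOfSchmidtNumber {p q : ℕ} (r : ℕ) (ψ : EuclideanSpace ℂ (Fin p × Fin q)) : Prop :=
  ‖ψ‖ = 1 ∧ ∃ (s : Fin r → ℝ) (e : Fin r → EuclideanSpace ℂ (Fin p))
    (f : Fin r → EuclideanSpace ℂ (Fin q)),
    (∀ i, 0 < s i) ∧ Orthonormal ℂ e ∧ Orthonormal ℂ f ∧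
      ∀ k l, ψ (k, l) = ∑ i, (s i : ℂ) * e i k * f i l

/-- The two-qubit gate `diag (1, 1, 1, e^{iθ})`. -/
noncomputable def gate (θ : ℝ) : Matrix (Fin 2 × Fin 2) (Fin 2 × Fin 2) ℂ :=
  Matrix.diagonal fun ij => if ij = (1, 1) then Complex.exp (θ * Complex.I) else 1

/-- The state `ρ ⊗ |ψ⟩⟨ψ|` of input and resource, with Alice's system (input qubit and her part
of the resource) and Bob's system grouped together: `ℂ² ⊗ ℂ^p` and `ℂ² ⊗ ℂ^q`. -/
noncomputable def joint {p q : ℕ} (ρ : Matrix (Fin 2 × Fin 2) (Fin 2 × Fin 2) ℂ)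
    (ψ : EuclideanSpace ℂ (Fin p × Fin q)) :
    Matrix (Fin (2 * p) × Fin (2 * q)) (Fin (2 * p) × Fin (2 * q)) ℂ :=
  fun x y =>
    let α := finProdFinEquiv.symm x.1
    let β := finProdFinEquiv.symm x.2
    let α' := finProdFinEquiv.symm y.1
    let β' := finProdFinEquiv.symm y.2
    ρ (α.1, β.1) (α'.1, β'.1) * (ψ (α.2, β.2) * star (ψ (α'.2, β'.2)))

/-- The protocol, assisted by the resource `ψ`, deterministically implements `U` on all (unknown)
two-qubit input states. -/
def Protocol.Implements {n p q : ℕ} (P : Protocol n (2 * p) (2 * q))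
    (ψ : EuclideanSpace ℂ (Fin p × Fin q)) (U : Matrix (Fin 2 × Fin 2) (Fin 2 × Fin 2) ℂ) : Prop :=
  ∀ ρ, IsState ρ → P.run (joint ρ ψ) = U * ρ * Uᴴ

/-- The unnormalized state, for the input `ρ`, of a branch with accumulated operators `A`, `B`. -/
noncomputable def branchState {p q a b : ℕ} (ψ : EuclideanSpace ℂ (Fin p × Fin q))
    (A : Matrix (Fin a) (Fin (2 * p)) ℂ) (B : Matrix (Fin b) (Fin (2 * q)) ℂ)
    (ρ : Matrix (Fin 2 × Fin 2) (Fin 2 × Fin 2) ℂ) : Matrix (Fin a × Fin b) (Fin a × Fin b) ℂ :=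
  (A ⊗ₖ B) * joint ρ ψ * (A ⊗ₖ B)ᴴ

/-- The branch with accumulated operators `A`, `B` has positive probability for some input. -/
def Occurs {p q a b : ℕ} (ψ : EuclideanSpace ℂ (Fin p × Fin q))
    (A : Matrix (Fin a) (Fin (2 * p)) ℂ) (B : Matrix (Fin b) (Fin (2 * q)) ℂ) : Prop :=
  ∃ ρ, IsState ρ ∧ branchState ψ A B ρ ≠ 0

/-- The positive square root of the block `⟨k| A†A |k⟩` of `A†A`, where `|k⟩` belongs to the input
qubit; an operator on the party's part `ℂ^p` of the resource. -/
noncomputable def block {a p : ℕ} (A : Matrix (Fin a) (Fin (2 * p)) ℂ) (k : Fin 2) :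
    Matrix (Fin p) (Fin p) ℂ :=
  CFC.sqrt ((Aᴴ * A).submatrix (fun x => finProdFinEquiv (k, x)) (fun x => finProdFinEquiv (k, x)))

/-- On the range of the accumulated operator `A`, the measurement `M` acts as a random unitary
operation: outcome `i` has a probability `w i` that does not depend on the state, and the operator
applied then is `√(w i) • V i` with `V i` preserving inner products on the range of `A`. -/
def ActsAsRandomUnitary {r a c : ℕ} {d : Fin r → ℕ} (M : ∀ i, Matrix (Fin (d i)) (Fin a) ℂ)
    (A : Matrix (Fin a) (Fin c) ℂ) : Prop :=
  ∃ (w : Fin r → ℝ) (V : ∀ i, Matrix (Fin (d i)) (Fin a) ℂ),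
    (∀ i, 0 ≤ w i) ∧ ∑ i, w i = 1 ∧ (∀ i, M i * A = ((√(w i) : ℝ) : ℂ) • (V i * A)) ∧
      ∀ i, w i ≠ 0 → (V i * A)ᴴ * (V i * A) = Aᴴ * A

end LOCC

/-!
If a protocol implements the gate, every Kraus operator of its remaining turns, composed with the
branch operator reached so far, is a multiple of the gate, because a sum of conjugations can act on
all states as a unitary conjugation only if each summand does. Write the resource as
`∑ j, E j ⊗ F j` with two terms, and let `P i i'` and `Q k k'` be the blocks of the Gram matrices of
the two parties' accumulated operators, indexed by the basis states of the input qubits. The Kraus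
operators have product form and the phase matrix `!![1, 1; 1, e]` is invertible, so these blocks
satisfy linear relations; as `e ≠ 1` has modulus one, the relations make the off-diagonal blocks
vanish, force `det (P 0 0) = det (P 1 1)`, and determine `P` from `P 0 0` and `Q`.

If `P 0 0` has rank one, a measurement can only rescale it, hence rescales all of `P`: this is a
random unitary operation. In general `(P 0 0)ᵀ` is a sum of two rank-one matrices `x x†`, where `x`
has the same norm for both `Q 0 0` and `Q 1 1`; each `x` has a partner `y`, orthogonal to a
combination of `Q 0 0 x` and `Q 1 1 x`, such that the `y y†` sum up to `(P 1 1)ᵀ`. Alice first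
measures which pair `(x, y)` occurs, Bob then completes the gate up to a phase on Alice's qubit, and
Alice corrects that phase.
-/

namespace LOCC

open Matrix

section Measurement

variable {ι 𝕜 : Type*} [Fintype ι] [RCLike 𝕜]

theorem sum_conjTranspose_mul_self_mul {k n : Type*} {m : ι → Type*} [∀ i, Fintype (m i)]
    [Fintype n] (N : ∀ i, Matrix (m i) n 𝕜) (Z : Matrix n k 𝕜) :
    ∑ i, (N i * Z)ᴴ * (N i * Z) = Zᴴ * (∑ i, (N i)ᴴ * N i) * Z := by
  simp only [conjTranspose_mul, Matrix.mul_sum, Matrix.sum_mul, Matrix.mul_assoc]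

theorem sum_conjTranspose_mul_self_mul_of_eq {k l n m : Type*} [Fintype l] [Fintype m]
    [Fintype n] {N : ι → Matrix m n 𝕜} {T : Matrix l n 𝕜} (h : ∑ i, (N i)ᴴ * N i = Tᴴ * T)
    (Z : Matrix n k 𝕜) : ∑ i, (N i * Z)ᴴ * (N i * Z) = (T * Z)ᴴ * (T * Z) := by
  rw [sum_conjTranspose_mul_self_mul, h, conjTranspose_mul]
  simp only [Matrix.mul_assoc]

theorem sum_sigma_conjTranspose_mul_self {l n : Type*} {κ m : ι → Type*} [∀ i, Fintype (κ i)]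
    [Fintype l] [∀ i, Fintype (m i)] [∀ i, DecidableEq (m i)] [DecidableEq n]
    {M : ∀ i, Matrix (m i) n 𝕜} {L : ∀ i, κ i → Matrix l (m i) 𝕜}
    (hM : ∑ i, (M i)ᴴ * M i = 1) (hL : ∀ i, ∑ s, (L i s)ᴴ * L i s = 1) :
    ∑ s : Σ i, κ i, (L s.1 s.2 * M s.1)ᴴ * (L s.1 s.2 * M s.1) = 1 := by
  rw [Fintype.sum_sigma, ← hM]
  refine Finset.sum_congr rfl fun i _ => (sum_conjTranspose_mul_self_mul (L i) (M i)).trans ?_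
  rw [hL, Matrix.mul_one]

theorem sum_kronecker {m m' n n' : Type*} (M : ι → Matrix m m' 𝕜) (N : Matrix n n' 𝕜) :
    ∑ i, M i ⊗ₖ N = (∑ i, M i) ⊗ₖ N := by
  ext x y
  simp only [Matrix.sum_apply, kroneckerMap_apply, Finset.sum_mul]

theorem kronecker_sum {m m' n n' : Type*} (M : Matrix m m' 𝕜) (N : ι → Matrix n n' 𝕜) :
    ∑ i, M ⊗ₖ N i = M ⊗ₖ ∑ i, N i := by
  ext x y
  simp only [Matrix.sum_apply, kroneckerMap_apply, Finset.mul_sum]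

theorem sum_conjTranspose_mul_self_kronecker_one {n k : Type*} {m : ι → Type*}
    [∀ i, Fintype (m i)] [DecidableEq n] [Fintype k] [DecidableEq k]
    {M : ∀ i, Matrix (m i) n 𝕜} (h : ∑ i, (M i)ᴴ * M i = 1) :
    ∑ i, (M i ⊗ₖ (1 : Matrix k k 𝕜))ᴴ * (M i ⊗ₖ (1 : Matrix k k 𝕜)) = 1 := by
  simp only [conjTranspose_kronecker, conjTranspose_one, ← mul_kronecker_mul, Matrix.mul_one,
    sum_kronecker, h, one_kronecker_one]

theorem sum_conjTranspose_mul_self_one_kronecker {n k : Type*} {m : ι → Type*}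
    [∀ i, Fintype (m i)] [DecidableEq n] [Fintype k] [DecidableEq k]
    {M : ∀ i, Matrix (m i) n 𝕜} (h : ∑ i, (M i)ᴴ * M i = 1) :
    ∑ i, ((1 : Matrix k k 𝕜) ⊗ₖ M i)ᴴ * ((1 : Matrix k k 𝕜) ⊗ₖ M i) = 1 := by
  simp only [conjTranspose_kronecker, conjTranspose_one, ← mul_kronecker_mul, Matrix.mul_one,
    kronecker_sum, h, one_kronecker_one]

theorem eq_zero_of_sum_conjTranspose_mul_self_eq_zero {m n : Type*} [Fintype m] [Finite n]
    {N : ι → Matrix m n 𝕜} (h : ∑ i, (N i)ᴴ * N i = 0) (i : ι) : N i = 0 :=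
  conjTranspose_mul_self_eq_zero.1 <| (Finset.sum_eq_zero_iff_of_nonneg fun j _ =>
    (posSemidef_conjTranspose_mul_self (N j)).nonneg).1 h i (Finset.mem_univ i)

theorem exists_isHermitian_mul_mul_eq_self {n : Type*} [Fintype n] {G : Matrix n n 𝕜}
    (hG : G.IsHermitian) : ∃ R : Matrix n n 𝕜, R.IsHermitian ∧ G * R * G = G := by
  classical
  have hcont (f : ℝ → ℝ) : ContinuousOn f (spectrum ℝ G) := finite_real_spectrum.continuousOn f
  have hG' : IsSelfAdjoint G := hG
  refine ⟨cfc (fun x : ℝ => x⁻¹) G, cfc_predicate _ G, ?_⟩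
  calc G * cfc (fun x : ℝ => x⁻¹) G * G
      = cfc (fun x : ℝ => x * x⁻¹ * x) G := by
        rw [cfc_mul (fun x : ℝ => x * x⁻¹) (fun x => x) G (hcont _) (hcont _),
          cfc_mul (fun x : ℝ => x) (fun x => x⁻¹) G (hcont _) (hcont _), cfc_id' ℝ G]
    _ = G := by simp only [mul_inv_mul_cancel, cfc_id' ℝ G]

theorem exists_isHermitian_mul_and_mul_mul_eq_self {m n : Type*} [Fintype m] [Fintype n]
    (T : Matrix m n 𝕜) : ∃ X : Matrix n m 𝕜, (T * X).IsHermitian ∧ T * X * T = T := by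
  classical
  obtain ⟨R, hR, hGRG⟩ :=
    exists_isHermitian_mul_mul_eq_self (isHermitian_conjTranspose_mul_self T)
  refine ⟨R * Tᴴ, ?_, ?_⟩
  · rw [← Matrix.mul_assoc]
    exact isHermitian_mul_mul_conjTranspose T hR
  · have hzero : Tᴴ * T * (R * (Tᴴ * T) - 1) = 0 := by
      rw [Matrix.mul_sub, ← Matrix.mul_assoc, hGRG, Matrix.mul_one, sub_self]
    have hT : T * (R * (Tᴴ * T) - 1) = 0 := by
      rw [← conjTranspose_mul_self_eq_zero, conjTranspose_mul, Matrix.mul_assoc,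
        ← Matrix.mul_assoc Tᴴ, hzero, Matrix.mul_zero]
    rw [Matrix.mul_sub, Matrix.mul_one, sub_eq_zero] at hT
    simpa only [Matrix.mul_assoc] using hT

theorem sum_conjTranspose_mul_self_single {m n : Type*} [Fintype m] [DecidableEq m]
    [Fintype n] [DecidableEq n] (x : m) :
    ∑ y : n, (single x y (1 : 𝕜))ᴴ * single x y (1 : 𝕜) = 1 := by
  simp only [conjTranspose_single, star_one, single_mul_single_same, mul_one, sum_single_one]

theorem exists_measurement_extending {l m n : Type*} [Fintype l] [Nonempty l] [Fintype m]
    [DecidableEq m] [Finite n] {T : Matrix m n 𝕜} {N : ι → Matrix l n 𝕜}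
    (h : ∑ j, (N j)ᴴ * N j = Tᴴ * T) :
    ∃ M : ι ⊕ m → Matrix l m 𝕜, ∑ s, (M s)ᴴ * M s = 1 ∧
      (∀ j, M (Sum.inl j) * T = N j) ∧ ∀ s, M (Sum.inr s) * T = 0 := by
  classical
  have := Fintype.ofFinite n
  obtain ⟨X, hX, hTXT⟩ := exists_isHermitian_mul_and_mul_mul_eq_self T
  have hproj : (T * X)ᴴ * (T * X) = T * X := by rw [hX.eq, ← Matrix.mul_assoc, hTXT]
  have hcompl : (1 - T * X)ᴴ * (1 - T * X) = 1 - T * X := by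
    rw [conjTranspose_sub, conjTranspose_one, Matrix.sub_mul, Matrix.one_mul, Matrix.mul_sub,
      hproj, Matrix.mul_one, hX.eq, sub_self, sub_zero]
  have hsupport (j : ι) : N j * X * T = N j := by
    have hT : T * (X * T - 1) = 0 := by
      rw [Matrix.mul_sub, ← Matrix.mul_assoc, hTXT, Matrix.mul_one, sub_self]
    have hN := eq_zero_of_sum_conjTranspose_mul_self_eq_zero
      ((sum_conjTranspose_mul_self_mul_of_eq h (X * T - 1)).trans (by rw [hT, Matrix.mul_zero])) j
    rwa [Matrix.mul_sub, Matrix.mul_one, sub_eq_zero, ← Matrix.mul_assoc] at hN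
  obtain ⟨x⟩ := ‹Nonempty l›
  refine ⟨Sum.elim (fun j => N j * X) fun s => single x s (1 : 𝕜) * (1 - T * X), ?_, hsupport,
    fun s => ?_⟩
  · simp only [Fintype.sum_sum_type, Sum.elim_inl, Sum.elim_inr]
    rw [sum_conjTranspose_mul_self_mul_of_eq h, hproj, sum_conjTranspose_mul_self_mul,
      sum_conjTranspose_mul_self_single, Matrix.mul_one, hcompl, add_sub_cancel]
  · rw [Sum.elim_inr, Matrix.mul_assoc, Matrix.sub_mul, Matrix.one_mul, hTXT, sub_self,
      Matrix.mul_zero]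

end Measurement

section Homothety

variable {ι κ : Type*} [Fintype ι] [Fintype κ]

theorem eq_smul_of_sum_vecMulVec_star_eq {x : ι → κ → ℂ} {v : κ → ℂ} {w : ℂ}
    (hv : star v ⬝ᵥ v = 1)
    (h : ∑ s, vecMulVec (x s) (star (x s)) = w • vecMulVec v (star v)) (s : ι) :
    x s = (star v ⬝ᵥ x s) • v := by
  let y := x s - (star v ⬝ᵥ x s) • v
  have hvy : star v ⬝ᵥ y = 0 := by
    rw [dotProduct_sub, dotProduct_smul, hv, smul_eq_mul, mul_one, sub_self]
  have hyv : star y ⬝ᵥ v = 0 := by rw [star_dotProduct, hvy, star_zero]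
  have hterm (t : ι) : star y ⬝ᵥ (vecMulVec (x t) (star (x t)) *ᵥ y) =
      star (star (x t) ⬝ᵥ y) * (star (x t) ⬝ᵥ y) := by
    rw [vecMulVec_mulVec, dotProduct_smul, star_dotProduct y, MulOpposite.smul_eq_mul_unop,
      MulOpposite.unop_op]
  have hsum : ∑ t, star (star (x t) ⬝ᵥ y) * (star (x t) ⬝ᵥ y) = 0 := by
    simp only [← hterm, ← dotProduct_sum, ← sum_mulVec]
    rw [h, smul_mulVec, vecMulVec_mulVec, hvy, MulOpposite.op_zero, zero_smul, smul_zero,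
      dotProduct_zero]
  have hxy : star (x s) ⬝ᵥ y = 0 := by
    simpa using (Finset.sum_eq_zero_iff_of_nonneg fun t _ => star_mul_self_nonneg _).1 hsum s
      (Finset.mem_univ s)
  have hyy : star y ⬝ᵥ y = 0 := by
    calc star y ⬝ᵥ y = star y ⬝ᵥ (x s - (star v ⬝ᵥ x s) • v) := rfl
      _ = 0 := by
        rw [dotProduct_sub, dotProduct_smul, hyv, smul_zero, sub_zero, star_dotProduct, hxy,
          star_zero]
  exact sub_eq_zero.1 (dotProduct_star_self_eq_zero.1 hyy)

theorem exists_eq_smul_one_of_forall_mulVec_eq_smul [DecidableEq κ] {M : Matrix κ κ ℂ}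
    (h : ∀ v : κ → ℂ, star v ⬝ᵥ v = 1 → ∃ c : ℂ, M *ᵥ v = c • v) :
    ∃ c : ℂ, M = c • (1 : Matrix κ κ ℂ) := by
  obtain ⟨c, hc⟩ : ∃ c : ℂ, M.mulVecLin = c • (1 : (κ → ℂ) →ₗ[ℂ] κ → ℂ) := by
    refine LinearMap.exists_eq_smul_id_of_forall_notLinearIndependent fun v hli => ?_
    have hpos : 0 < star v ⬝ᵥ v := dotProduct_star_self_pos_iff.2 (hli.ne_zero 0)
    obtain ⟨r, hr⟩ := CStarAlgebra.nonneg_iff_eq_star_mul_self.1 (inv_pos.2 hpos).le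
    have hr0 : r ≠ 0 := by
      rintro rfl
      exact inv_ne_zero hpos.ne' (hr.trans (mul_zero _))
    obtain ⟨c, hc⟩ := h (r • v) (by
      rw [star_smul, smul_dotProduct, dotProduct_smul, smul_smul, ← hr, smul_eq_mul,
        inv_mul_cancel₀ hpos.ne'])
    have hv : M *ᵥ v = c • v := by
      rw [mulVec_smul, smul_comm c r] at hc
      exact smul_right_injective _ hr0 hc
    have hdep := LinearIndependent.pair_iff.1 hli c (-1) (by
      rw [mulVecLin_apply, hv, neg_one_smul, add_neg_cancel])
    exact neg_ne_zero.2 one_ne_zero hdep.2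
  refine ⟨c, toLin'.injective ?_⟩
  rw [toLin'_apply', hc, map_smul, toLin'_one]
  rfl

theorem exists_eq_smul_of_sum_mul_mul_conjTranspose_eq {κ : Type} [Fintype κ] [DecidableEq κ]
    {L : ι → Matrix κ κ ℂ} {U : Matrix κ κ ℂ} (hU : Uᴴ * U = 1) {w : ℂ}
    (h : ∀ ρ, IsState ρ → ∑ s, L s * ρ * (L s)ᴴ = w • (U * ρ * Uᴴ)) (s : ι) :
    ∃ c : ℂ, L s = c • U := by
  obtain ⟨c, hc⟩ : ∃ c : ℂ, Uᴴ * L s = c • (1 : Matrix κ κ ℂ) := by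
    refine exists_eq_smul_one_of_forall_mulVec_eq_smul fun v hv => ⟨star v ⬝ᵥ ((Uᴴ * L s) *ᵥ v), ?_⟩
    refine eq_smul_of_sum_vecMulVec_star_eq (x := fun s => (Uᴴ * L s) *ᵥ v) (w := w) hv ?_ s
    have hstate : IsState (vecMulVec v (star v)) :=
      ⟨posSemidef_vecMulVec_self_star v, by rw [trace_vecMulVec, dotProduct_comm, hv]⟩
    calc ∑ t, vecMulVec ((Uᴴ * L t) *ᵥ v) (star ((Uᴴ * L t) *ᵥ v))
        = Uᴴ * (∑ t, L t * vecMulVec v (star v) * (L t)ᴴ) * U := by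
          simp only [← mulVec_mulVec, star_mulVec, ← vecMulVec_mul, ← mul_vecMulVec,
            Matrix.mul_sum, Matrix.sum_mul, conjTranspose_conjTranspose, Matrix.mul_assoc]
      _ = w • ((Uᴴ * U) * vecMulVec v (star v) * (Uᴴ * U)) := by
          rw [h _ hstate]
          simp only [Matrix.mul_smul, Matrix.smul_mul, Matrix.mul_assoc]
      _ = w • vecMulVec v (star v) := by rw [hU, Matrix.one_mul, Matrix.mul_one]
  refine ⟨c, ?_⟩
  calc L s = U * (Uᴴ * L s) := by rw [← Matrix.mul_assoc, mul_eq_one_comm.1 hU, Matrix.one_mul]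
    _ = c • U := by rw [hc, Matrix.mul_smul, Matrix.mul_one]

end Homothety

section TwoByTwo

theorem mul_adjugate_add_mul_adjugate {R : Type*} [CommRing R] (A B : Matrix (Fin 2) (Fin 2) R) :
    A * adjugate B + B * adjugate A = (A * adjugate B).trace • (1 : Matrix (Fin 2) (Fin 2) R) := by
  ext i j
  fin_cases i <;> fin_cases j <;>
    simp [adjugate_fin_two, mul_apply, trace_fin_two] <;> ring

theorem mul_eq_smul_one_comm {n K : Type*} [Fintype n] [DecidableEq n] [Field K]
    {A B : Matrix n n K} {c : K} (hc : c ≠ 0) (h : A * B = c • (1 : Matrix n n K)) :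
    B * A = c • (1 : Matrix n n K) := by
  have hinv : A * (c⁻¹ • B) = 1 := by rw [Matrix.mul_smul, h, inv_smul_smul₀ hc]
  rw [← smul_inv_smul₀ hc (B * A), ← Matrix.smul_mul, mul_eq_one_comm.1 hinv]

/-- The vector orthogonal to `v` with the same norm. -/
def perp (v : Fin 2 → ℂ) : Fin 2 → ℂ := ![star (v 1), -star (v 0)]

theorem star_perp_dotProduct_mulVec_perp (M : Matrix (Fin 2) (Fin 2) ℂ) (u v : Fin 2 → ℂ) :
    star (perp v) ⬝ᵥ (M *ᵥ perp u) = star u ⬝ᵥ (adjugate M *ᵥ v) := by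
  simp only [perp, adjugate_fin_two, dotProduct, mulVec, Fin.sum_univ_two, Pi.star_apply, of_apply,
    cons_val', cons_val_zero, cons_val_one, cons_val_fin_one, star_neg, star_star]
  ring

theorem exists_unitary_diag_eq_zero {F : Matrix (Fin 2) (Fin 2) ℂ} (hF : F.IsHermitian)
    (htr : F.trace = 0) :
    ∃ U : Matrix (Fin 2) (Fin 2) ℂ, U * Uᴴ = 1 ∧ ∀ j, (Uᴴ * F * U) j j = 0 := by
  obtain ⟨u, hu, huF⟩ := Complex.exists_norm_eq_mul_self (F 0 1)
  have huu : u * (starRingEnd ℂ) u = 1 := by rw [Complex.mul_conj', hu]; norm_num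
  have hcross : (starRingEnd ℂ) u * F 1 0 = u * F 0 1 := by
    rw [← huF, ← hF.apply 1 0, Complex.star_def, ← map_mul, ← huF, Complex.conj_ofReal]
  rw [trace_fin_two] at htr
  let U : Matrix (Fin 2) (Fin 2) ℂ := !![1, 1; Complex.I * u, -(Complex.I * u)]
  have hU : U * Uᴴ = (2 : ℂ) • 1 := by
    have hI : (Complex.I * u) * (starRingEnd ℂ) (Complex.I * u) = 1 := by
      rw [Complex.mul_conj', norm_mul, Complex.norm_I, hu, mul_one, Complex.ofReal_one, one_pow]
    ext i j
    fin_cases i <;> fin_cases j <;>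
      simp [U, mul_apply, -map_mul, hI, one_add_one_eq_two]
  have hdiag (j : Fin 2) : (Uᴴ * F * U) j j = 0 := by
    fin_cases j <;>
      simp only [U, mul_apply, Fin.sum_univ_two, conjTranspose_apply, of_apply, cons_val',
        cons_val_zero, cons_val_one, cons_val_fin_one, Fin.zero_eta, Fin.mk_one, Complex.star_def,
        map_one, map_neg, map_mul, Complex.conj_I]
    · linear_combination htr - Complex.I * hcross
        - u * (starRingEnd ℂ) u * F 1 1 * Complex.I_sq + F 1 1 * huu
    · linear_combination htr + Complex.I * hcross
        - u * (starRingEnd ℂ) u * F 1 1 * Complex.I_sq + F 1 1 * huu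
  obtain ⟨r, hr⟩ := CStarAlgebra.nonneg_iff_eq_mul_star_self.1 (inv_nonneg.2 (zero_le_two (α := ℂ)))
  refine ⟨r • U, ?_, fun j => ?_⟩
  · rw [conjTranspose_smul, smul_mul_smul_comm, ← hr, hU, inv_smul_smul₀ two_ne_zero]
  · rw [conjTranspose_smul, Matrix.smul_mul, smul_mul_smul_comm, Matrix.smul_apply, hdiag,
      smul_zero]

theorem sum_vecMulVec_col {m n : Type*} [Fintype n] (S : Matrix m n ℂ) :
    ∑ j, vecMulVec (S.col j) (star (S.col j)) = S * Sᴴ := by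
  ext x y
  simp only [Matrix.sum_apply, mul_apply, vecMulVec_apply, col_apply, conjTranspose_apply,
    Pi.star_apply]

theorem exists_sum_vecMulVec_star_eq {G H : Matrix (Fin 2) (Fin 2) ℂ} (hG : G.PosSemidef)
    (hH : H.IsHermitian) (htr : (H * G).trace = 0) :
    ∃ x : Fin 2 → Fin 2 → ℂ, ∑ j, vecMulVec (x j) (star (x j)) = G ∧
      ∀ j, star (x j) ⬝ᵥ (H *ᵥ x j) = 0 := by
  obtain ⟨T, rfl⟩ := CStarAlgebra.nonneg_iff_eq_mul_star_self.1 hG.nonneg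
  rw [star_eq_conjTranspose] at *
  obtain ⟨U, hU, hdiag⟩ := exists_unitary_diag_eq_zero (isHermitian_conjTranspose_mul_mul T hH)
    (by rw [trace_mul_comm, ← Matrix.mul_assoc, trace_mul_comm, htr])
  refine ⟨(T * U).col, ?_, fun j => ?_⟩
  · rw [sum_vecMulVec_col, conjTranspose_mul, Matrix.mul_assoc, ← Matrix.mul_assoc U, hU,
      Matrix.one_mul]
  · have h := hdiag j
    rw [show Uᴴ * (Tᴴ * H * T) * U = (T * U)ᴴ * (H * (T * U)) by
      simp only [conjTranspose_mul, Matrix.mul_assoc]] at h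
    exact h

theorem exists_eq_smul_phase {x : Fin 2 → ℂ} (hx : ‖x 0‖ = ‖x 1‖) :
    ∃ c μ : ℂ, ‖μ‖ = 1 ∧ x = c • ![1, μ] := by
  obtain h0 | h0 := eq_or_ne (x 0) 0
  · have h1 : x 1 = 0 := by rwa [h0, norm_zero, eq_comm, norm_eq_zero] at hx
    refine ⟨0, 1, norm_one, ?_⟩
    ext i
    fin_cases i <;> simp [h0, h1]
  · refine ⟨x 0, x 1 / x 0, by rw [norm_div, hx, div_self (hx ▸ norm_ne_zero_iff.2 h0)], ?_⟩
    ext i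
    fin_cases i <;> simp [mul_div_cancel₀, h0]

theorem exists_sum_phase_eq {X : Matrix (Fin 2) (Fin 2) ℂ} (hX : X.PosSemidef)
    (hdiag : X 0 0 = X 1 1) :
    ∃ c μ : Fin 2 → ℂ, (∀ j, ‖μ j‖ = 1) ∧
      ∑ j, vecMulVec (c j • ![1, μ j]) (star (c j • ![1, μ j])) = X := by
  obtain ⟨x, hsum, hneutral⟩ := exists_sum_vecMulVec_star_eq (H := !![1, 0; 0, -1]) hX
    (by ext i j; fin_cases i <;> fin_cases j <;> simp)
    (by simp [trace_fin_two, vecMul_eq_sum, Fin.sum_univ_two, hdiag])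
  have hnorm (j : Fin 2) : ‖x j 0‖ = ‖x j 1‖ := by
    have h := hneutral j
    simp only [dotProduct, mulVec, Fin.sum_univ_two, Pi.star_apply, of_apply, cons_val',
      cons_val_zero, cons_val_one, cons_val_fin_one, one_mul, zero_mul, add_zero, zero_add, neg_mul,
      mul_neg, Complex.star_def, Complex.conj_mul', add_neg_eq_zero] at h
    norm_cast at h
    exact (sq_eq_sq₀ (norm_nonneg _) (norm_nonneg _)).1 h
  choose c μ hμ hx using fun j => exists_eq_smul_phase (hnorm j)
  exact ⟨c, μ, hμ, by simpa only [← hx] using hsum⟩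

end TwoByTwo

/-- Operators on a bipartite system with local dimensions `a` and `b`. -/
abbrev BipartiteOp (a b : ℕ) : Type :=
  Matrix (Fin a × Fin b) (Fin a × Fin b) ℂ

theorem mul_conj_mul_conjTranspose {k l m : Type*} [Fintype k] [Fintype l] (S : Matrix m l ℂ)
    (T : Matrix l k ℂ) (σ : Matrix k k ℂ) : S * (T * σ * Tᴴ) * Sᴴ = S * T * σ * (S * T)ᴴ := by
  simp only [conjTranspose_mul, Matrix.mul_assoc]

section Realizes

variable {ι κ : Type} [Fintype ι] {a b : ℕ}

/-- A map between operators on bipartite systems, with two-qubit output, that is trace preserving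
and has Kraus operators of product form; this is what the maps performed by LOCC protocols are. -/
def HasLocalKraus (Φ : BipartiteOp a b → BipartiteOp 2 2) : Prop :=
  ∃ (ι : Type) (_ : Fintype ι) (X : ι → Matrix (Fin 2) (Fin a) ℂ)
    (Y : ι → Matrix (Fin 2) (Fin b) ℂ), ∑ s, (X s ⊗ₖ Y s)ᴴ * (X s ⊗ₖ Y s) = 1 ∧
      ∀ σ, Φ σ = ∑ s, (X s ⊗ₖ Y s) * σ * (X s ⊗ₖ Y s)ᴴ

/-- After the preparation `V`, the map `Φ` acts on every input state as the operator `U`, up to the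
probability `w`. -/
def Realizes {m l k : Type} [Fintype m] [Fintype l] [Fintype k] (Φ : Matrix m m ℂ → Matrix l l ℂ)
    (V : Matrix m k ℂ) (U : Matrix l k ℂ) (w : ℂ) : Prop :=
  ∀ ρ : Matrix k k ℂ, IsState ρ → Φ (V * ρ * Vᴴ) = w • (U * ρ * Uᴴ)

theorem hasLocalKraus_id : HasLocalKraus (a := 2) (b := 2) fun σ => σ :=
  ⟨Unit, inferInstance, fun _ => 1, fun _ => 1, by simp, by simp⟩

theorem HasLocalKraus.sum_comp {d e : ι → ℕ} {M : ∀ i, Matrix (Fin (d i)) (Fin a) ℂ}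
    {K : ∀ i, Matrix (Fin (e i)) (Fin b) ℂ} (hMK : ∑ i, (M i ⊗ₖ K i)ᴴ * (M i ⊗ₖ K i) = 1)
    {Φ : ∀ i, BipartiteOp (d i) (e i) → BipartiteOp 2 2} (hΦ : ∀ i, HasLocalKraus (Φ i)) :
    HasLocalKraus fun σ : BipartiteOp a b => ∑ i, Φ i ((M i ⊗ₖ K i) * σ * (M i ⊗ₖ K i)ᴴ) := by
  choose κ _ X Y hXY hrun using hΦ
  refine ⟨Σ i, κ i, inferInstance, fun s => X s.1 s.2 * M s.1, fun s => Y s.1 s.2 * K s.1, ?_,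
    fun σ => ?_⟩
  · simp only [mul_kronecker_mul]
    exact sum_sigma_conjTranspose_mul_self (M := fun i => M i ⊗ₖ K i)
      (L := fun i s => X i s ⊗ₖ Y i s) hMK hXY
  · simp only [Fintype.sum_sigma, hrun, mul_kronecker_mul, conjTranspose_mul, Matrix.mul_assoc]

theorem exists_isState [Fintype κ] [Nonempty κ] : ∃ ρ : Matrix κ κ ℂ, IsState ρ := by
  classical
  obtain ⟨i⟩ := ‹Nonempty κ›
  refine ⟨vecMulVec (Pi.single i 1) (star (Pi.single i 1)), posSemidef_vecMulVec_self_star _, ?_⟩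
  simp [trace_vecMulVec]

variable [Fintype κ] [DecidableEq κ]

theorem Realizes.exists_eq_smul [Nonempty κ] {l : Type} [Fintype l]
    {Φ : Matrix l l ℂ → Matrix κ κ ℂ} {L : ι → Matrix κ l ℂ}
    (hL : ∀ σ, Φ σ = ∑ s, L s * σ * (L s)ᴴ) {V : Matrix l κ ℂ} {U : Matrix κ κ ℂ} {w : ℂ}
    (hU : Uᴴ * U = 1) (h : Realizes Φ V U w) :
    ∃ c : ι → ℂ, (∀ s, L s * V = c s • U) ∧ ∑ s, star (c s) * c s = w := by
  have hstate (ρ : Matrix κ κ ℂ) (hρ : IsState ρ) :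
      ∑ s, L s * V * ρ * (L s * V)ᴴ = w • (U * ρ * Uᴴ) := by
    simpa only [hL, mul_conj_mul_conjTranspose] using h ρ hρ
  choose c hc using exists_eq_smul_of_sum_mul_mul_conjTranspose_eq hU hstate
  obtain ⟨ρ, hρ⟩ := exists_isState (κ := κ)
  have htrace := congrArg trace (hstate ρ hρ)
  refine ⟨c, hc, ?_⟩
  simpa only [hc, conjTranspose_smul, Matrix.smul_mul, Matrix.mul_smul, smul_smul, trace_sum,
    trace_smul, ← Finset.sum_mul, trace_mul_cycle U, hU, Matrix.one_mul, hρ.2, smul_eq_mul,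
    mul_one] using htrace

theorem Realizes.conjTranspose_mul_self {Φ : BipartiteOp a b → BipartiteOp 2 2}
    (hΦ : HasLocalKraus Φ) {V : Matrix (Fin a × Fin b) (Fin 2 × Fin 2) ℂ} {U : BipartiteOp 2 2}
    {w : ℂ} (hU : Uᴴ * U = 1) (h : Realizes Φ V U w) : Vᴴ * V = w • 1 := by
  obtain ⟨κ, _, X, Y, hXY, hrun⟩ := hΦ
  obtain ⟨c, hc, hw⟩ := h.exists_eq_smul hrun hU
  have hgram := sum_conjTranspose_mul_self_mul (fun s => X s ⊗ₖ Y s) V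
  rw [hXY, Matrix.mul_one] at hgram
  simpa only [hc, conjTranspose_smul, smul_mul_smul_comm, hU, ← Finset.sum_smul, hw]
    using hgram.symm

theorem Realizes.exists_of_sum_comp {d e : ι → ℕ}
    {Φ : ∀ i, BipartiteOp (d i) (e i) → BipartiteOp 2 2} (hΦ : ∀ i, HasLocalKraus (Φ i))
    {T : ∀ i, Matrix (Fin (d i) × Fin (e i)) (Fin a × Fin b) ℂ}
    {V : Matrix (Fin a × Fin b) (Fin 2 × Fin 2) ℂ}
    {U : BipartiteOp 2 2} {w : ℂ} (hU : Uᴴ * U = 1)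
    (h : Realizes (fun σ : BipartiteOp a b => ∑ i, Φ i (T i * σ * (T i)ᴴ)) V U w) (i : ι) :
    ∃ v, Realizes (Φ i) (T i * V) U v := by
  choose κ _ X Y _ hrun using hΦ
  obtain ⟨c, hc, -⟩ := h.exists_eq_smul
    (L := fun s : Σ i, κ i => (X s.1 s.2 ⊗ₖ Y s.1 s.2) * T s.1) (fun σ => by
      simp only [hrun, mul_conj_mul_conjTranspose, Fintype.sum_sigma]) hU
  refine ⟨∑ s, c ⟨i, s⟩ * star (c ⟨i, s⟩), fun ρ _ => ?_⟩
  have hci (s : κ i) : (X i s ⊗ₖ Y i s) * (T i * V) = c ⟨i, s⟩ • U := by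
    rw [← Matrix.mul_assoc, hc ⟨i, s⟩]
  simp only [hrun, mul_conj_mul_conjTranspose, hci, conjTranspose_smul, Matrix.smul_mul,
    Matrix.mul_smul, smul_smul, ← Finset.sum_smul, mul_comm (star _)]

variable {Φ Ψ : BipartiteOp a b → BipartiteOp 2 2}
  {V : Matrix (Fin a × Fin b) (Fin 2 × Fin 2) ℂ} {U : BipartiteOp 2 2}
  {v w : ℂ}

theorem Realizes.weight_eq (hΦ : HasLocalKraus Φ) (hΨ : HasLocalKraus Ψ) (hU : Uᴴ * U = 1)
    (h : Realizes Φ V U w) (h' : Realizes Ψ V U v) : w = v := by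
  have hV := (h.conjTranspose_mul_self hΦ hU).symm.trans (h'.conjTranspose_mul_self hΨ hU)
  simpa using congrFun₂ hV 0 0

theorem Realizes.weight_nonneg (hΦ : HasLocalKraus Φ) (hU : Uᴴ * U = 1) (h : Realizes Φ V U w) :
    0 ≤ w := by
  have hpos := (posSemidef_conjTranspose_mul_self V).diag_nonneg (i := 0)
  simpa [h.conjTranspose_mul_self hΦ hU] using hpos

theorem Realizes.eq_zero (hΦ : HasLocalKraus Φ) (hU : Uᴴ * U = 1) (h : Realizes Φ V U 0) :
    V = 0 := by
  rw [← conjTranspose_mul_self_eq_zero, h.conjTranspose_mul_self hΦ hU, zero_smul]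

end Realizes

namespace Protocol

theorem hasLocalKraus_run : {n a b : ℕ} → (P : Protocol n a b) → HasLocalKraus P.run
  | _, _, _, .done => hasLocalKraus_id
  | _, _, _, .alice _ _ _ hM next =>
      .sum_comp (sum_conjTranspose_mul_self_kronecker_one hM) fun i => (next i).hasLocalKraus_run
  | _, _, _, .bob _ _ _ hK next =>
      .sum_comp (sum_conjTranspose_mul_self_one_kronecker hK) fun i => (next i).hasLocalKraus_run

theorem IsNode.trans {l m n a b a' b' a'' b'' : ℕ} {P : Protocol n a b} {Q : Protocol m a' b'}
    {R : Protocol l a'' b''} {A : Matrix (Fin a') (Fin a) ℂ} {B : Matrix (Fin b') (Fin b) ℂ}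
    {C : Matrix (Fin a'') (Fin a') ℂ} {D : Matrix (Fin b'') (Fin b') ℂ}
    (hR : R.IsNode Q C D) (hQ : Q.IsNode P A B) : R.IsNode P (C * A) (D * B) := by
  induction hQ with
  | here => rwa [Matrix.mul_one, Matrix.mul_one]
  | alice i _ ih => rw [← Matrix.mul_assoc]; exact .alice i ih
  | bob i _ ih => rw [← Matrix.mul_assoc]; exact .bob i ih

theorem IsNode.exists_realizes {m n a b a' b' : ℕ} {P : Protocol n a b} {Q : Protocol m a' b'}
    {A : Matrix (Fin a') (Fin a) ℂ} {B : Matrix (Fin b') (Fin b) ℂ} (hQ : Q.IsNode P A B)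
    {V : Matrix (Fin a × Fin b) (Fin 2 × Fin 2) ℂ} {U : BipartiteOp 2 2}
    {w : ℂ} (hU : Uᴴ * U = 1) (h : Realizes P.run V U w) :
    ∃ v, Realizes Q.run ((A ⊗ₖ B) * V) U v := by
  induction hQ generalizing w with
  | here => exact ⟨w, by rwa [one_kronecker_one, Matrix.one_mul]⟩
  | alice i _ ih =>
    obtain ⟨v, hv⟩ := Realizes.exists_of_sum_comp (fun _ => hasLocalKraus_run _) hU h i
    simpa only [← Matrix.mul_assoc, ← mul_kronecker_mul, Matrix.mul_one] using ih hv
  | bob i _ ih =>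
    obtain ⟨v, hv⟩ := Realizes.exists_of_sum_comp (fun _ => hasLocalKraus_run _) hU h i
    simpa only [← Matrix.mul_assoc, ← mul_kronecker_mul, Matrix.mul_one] using ih hv

theorem exists_sameFirst {m m' : ℕ} {τ : Type} : ∀ (k : ℕ) {a b : ℕ} (P : Protocol (m + k) a b)
    (σ : τ → BipartiteOp a b),
    (∀ {a' b' : ℕ} (Q : Protocol m a' b') (A : Matrix (Fin a') (Fin a) ℂ)
      (B : Matrix (Fin b') (Fin b) ℂ), Q.IsNode P A B → ∃ Q' : Protocol m' a' b',
        ∀ t, Q'.run ((A ⊗ₖ B) * σ t * (A ⊗ₖ B)ᴴ) = Q.run ((A ⊗ₖ B) * σ t * (A ⊗ₖ B)ᴴ)) →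
    ∃ P' : Protocol (m' + k) a b, P'.SameFirst k P ∧ ∀ t, P'.run (σ t) = P.run (σ t)
  | 0, _, _, P, _, h => by
    obtain ⟨P', hP'⟩ := h P 1 1 .here
    exact ⟨P', .zero _ _, by simpa only [one_kronecker_one, conjTranspose_one, Matrix.one_mul,
      Matrix.mul_one] using hP'⟩
  | k + 1, a, b, .alice r d M hM next, σ, h => by
    let T (i : Fin r) := M i ⊗ₖ (1 : Matrix (Fin b) (Fin b) ℂ)
    choose next' hsame hrun using fun i => exists_sameFirst k (next i)
      (fun t => T i * σ t * (T i)ᴴ) fun Q A B hQ => by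
        simpa only [mul_conj_mul_conjTranspose, T, ← mul_kronecker_mul, Matrix.mul_one]
          using h Q (A * M i) B (.alice i hQ)
    exact ⟨.alice r d M hM next', .alice hsame, fun t => Finset.sum_congr rfl fun i _ => hrun i t⟩
  | k + 1, a, b, .bob r d K hK next, σ, h => by
    let T (i : Fin r) := (1 : Matrix (Fin a) (Fin a) ℂ) ⊗ₖ K i
    choose next' hsame hrun using fun i => exists_sameFirst k (next i)
      (fun t => T i * σ t * (T i)ᴴ) fun Q A B hQ => by
        simpa only [mul_conj_mul_conjTranspose, T, ← mul_kronecker_mul, Matrix.mul_one]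
          using h Q A (B * K i) (.bob i hQ)
    exact ⟨.bob r d K hK next', .bob hsame, fun t => Finset.sum_congr rfl fun i _ => hrun i t⟩

end Protocol

section BranchOperator

variable {m n κ : Type*}

/-- The branch operator of a resource `∑ j, |j⟩ ⊗ |j⟩` consumed by local operators: `A i` and `B k`
act on the two halves of the resource when the input qubits are in the basis states `i` and `k`. -/
def pairOp [Fintype κ] (A : Fin 2 → Matrix m κ ℂ) (B : Fin 2 → Matrix n κ ℂ) :
    Matrix (m × n) (Fin 2 × Fin 2) ℂ :=
  fun x i => ∑ j, (A i.1 ⊗ₖ B i.2) x (j, j)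

/-- The blocks, with respect to the input qubit, of `T† T` for an operator `T` with blocks `A`. -/
def gram [Fintype m] (A : Fin 2 → Matrix m κ ℂ) (i i' : Fin 2) : Matrix κ κ ℂ :=
  (A i)ᴴ * A i'

theorem gram_posSemidef [Fintype m] [Finite κ] (A : Fin 2 → Matrix m κ ℂ) (i : Fin 2) :
    (gram A i i).PosSemidef :=
  posSemidef_conjTranspose_mul_self (A i)

theorem gram_kronecker_gram [Fintype m] [Fintype n] (A : Fin 2 → Matrix m κ ℂ)
    (B : Fin 2 → Matrix n κ ℂ) (i i' k k' : Fin 2) :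
    gram A i i' ⊗ₖ gram B k k' = (A i ⊗ₖ B k)ᴴ * (A i' ⊗ₖ B k') := by
  rw [conjTranspose_kronecker, ← mul_kronecker_mul, gram, gram]

variable [Fintype κ]

theorem kronecker_mul_pairOp {m' n' : Type*} [Fintype m] [Fintype n] (X : Matrix m' m ℂ)
    (Y : Matrix n' n ℂ) (A : Fin 2 → Matrix m κ ℂ) (B : Fin 2 → Matrix n κ ℂ) :
    (X ⊗ₖ Y) * pairOp A B = pairOp (fun i => X * A i) (fun k => Y * B k) := by
  ext x i
  simp only [pairOp, mul_kronecker_mul, mul_apply, Finset.mul_sum]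
  exact Finset.sum_comm

theorem sum_transpose_gram_mul_gram {ι m' n' : Type*} [Fintype ι] [Fintype m] [Fintype n]
    [Fintype m'] [Fintype n'] [DecidableEq m] [DecidableEq n] {X : ι → Matrix m' m ℂ}
    {Y : ι → Matrix n' n ℂ} (h : ∑ s, (X s ⊗ₖ Y s)ᴴ * (X s ⊗ₖ Y s) = 1)
    (A : Fin 2 → Matrix m κ ℂ) (B : Fin 2 → Matrix n κ ℂ) (i i' k k' : Fin 2) :
    ∑ s, (gram (fun i => X s * A i) i i')ᵀ * gram (fun k => Y s * B k) k k' =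
      (gram A i i')ᵀ * gram B k k' := by
  have hgram : ∑ s, gram (fun i => X s * A i) i i' ⊗ₖ gram (fun k => Y s * B k) k k' =
      gram A i i' ⊗ₖ gram B k k' := by
    calc _ = (A i ⊗ₖ B k)ᴴ * (∑ s, (X s ⊗ₖ Y s)ᴴ * (X s ⊗ₖ Y s)) * (A i' ⊗ₖ B k') := by
          simp only [gram_kronecker_gram, mul_kronecker_mul, conjTranspose_mul, Matrix.mul_sum,
            Matrix.sum_mul, Matrix.mul_assoc]
      _ = _ := by rw [h, Matrix.mul_one, gram_kronecker_gram]
  ext j l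
  have hentry := congrArg (fun G => ∑ m, G (m, m) (j, l)) hgram
  simp only [Matrix.sum_apply, kroneckerMap_apply] at hentry
  rw [Finset.sum_comm] at hentry
  simpa only [Matrix.sum_apply, mul_apply, transpose_apply] using hentry

end BranchOperator

section Phase

/-- The matrix of the diagonal entries of a two-qubit controlled phase gate, indexed by the two
qubits. -/
def phase (e : ℂ) : Matrix (Fin 2) (Fin 2) ℂ :=
  !![1, 1; 1, e]

/-- The two-qubit gate that multiplies `|11⟩` by `e`. -/
def phaseGate (e : ℂ) : Matrix (Fin 2 × Fin 2) (Fin 2 × Fin 2) ℂ :=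
  diagonal fun x => phase e x.1 x.2

theorem gate_eq_phaseGate (θ : ℝ) : gate θ = phaseGate (Complex.exp (θ * Complex.I)) := by
  refine congrArg diagonal (funext fun ⟨i, k⟩ => ?_)
  fin_cases i <;> fin_cases k <;> simp [phase]

theorem det_phase (e : ℂ) : (phase e).det = e - 1 := by
  rw [phase, det_fin_two_of, one_mul, one_mul]

theorem phaseGate_conjTranspose_mul_self {e : ℂ} (he : ‖e‖ = 1) :
    (phaseGate e)ᴴ * phaseGate e = 1 := by
  rw [phaseGate, diagonal_conjTranspose, diagonal_mul_diagonal, diagonal_eq_one]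
  ext ⟨i, k⟩
  fin_cases i <;> fin_cases k <;> simp [phase, Complex.conj_mul', he]

/-- The relations between the blocks `P`, `Q` of the two parties that hold when the branch operator
implements the phase gate with phase `e` and probability `w`. If the operators are of the
form `A i = |i⟩⟨α i|` and `B k = |k⟩⟨β k|`, then the matrices with rows `α i` and `β k` satisfy
`αᵀ * adjugate (phase e) * β = (c * (e - 1)) • 1`, and `cross` is this identity times `star c`. -/
structure Balanced (e w : ℂ) (P Q : Fin 2 → Fin 2 → Matrix (Fin 2) (Fin 2) ℂ) : Prop where
  offDiag : ∀ i i' k k', i ≠ i' ∨ k ≠ k' → (P i i')ᵀ * Q k k' = 0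
  trace : ∀ i k, ((P i i)ᵀ * Q k k).trace = w
  cross : (P 0 0)ᵀ * (e • Q 0 0 - Q 1 1) + (P 1 1)ᵀ * (e • Q 1 1 - Q 0 0) = (w * (e - 1)) • 1

namespace Balanced

variable {e w : ℂ} {P Q : Fin 2 → Fin 2 → Matrix (Fin 2) (Fin 2) ℂ}

theorem symm (h : Balanced e w P Q) : Balanced e w Q P where
  offDiag k k' i i' hne := by
    rw [← transpose_eq_zero, transpose_mul, transpose_transpose, h.offDiag _ _ _ _ hne.symm]
  trace k i := by rw [← trace_transpose, transpose_mul, transpose_transpose, h.trace]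
  cross := by
    rw [← transpose_inj, transpose_smul, transpose_one, ← h.cross]
    simp only [transpose_add, transpose_mul, transpose_sub, transpose_smul, transpose_transpose,
      Matrix.mul_sub, Matrix.mul_smul]
    abel

theorem smul (h : Balanced e w P Q) (l : ℂ) : Balanced e (l * w) (l • P) Q where
  offDiag i i' k k' hne := by
    rw [Pi.smul_apply, Pi.smul_apply, transpose_smul, Matrix.smul_mul, h.offDiag _ _ _ _ hne,
      smul_zero]
  trace i k := by
    rw [Pi.smul_apply, Pi.smul_apply, transpose_smul, Matrix.smul_mul, trace_smul, h.trace,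
      smul_eq_mul]
  cross := by
    simp only [Pi.smul_apply, transpose_smul, Matrix.smul_mul]
    rw [← smul_add, h.cross, smul_smul, mul_assoc]

theorem of_sum {ι : Type*} [Fintype ι] {v : ι → ℂ}
    {R S : ι → Fin 2 → Fin 2 → Matrix (Fin 2) (Fin 2) ℂ} (h : ∀ s, Balanced e (v s) (R s) (S s))
    (hsum : ∀ i i' k k', ∑ s, (R s i i')ᵀ * S s k k' = (P i i')ᵀ * Q k k') :
    Balanced e (∑ s, v s) P Q where
  offDiag i i' k k' hne := by
    rw [← hsum, Finset.sum_eq_zero fun s _ => (h s).offDiag i i' k k' hne]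
  trace i k := by
    rw [← hsum, trace_sum]
    exact Finset.sum_congr rfl fun s _ => (h s).trace i k
  cross := by
    rw [Finset.sum_mul, Finset.sum_smul, ← Finset.sum_congr rfl fun s _ => (h s).cross]
    simp only [Matrix.mul_sub, Matrix.mul_smul, ← hsum, Finset.sum_add_distrib,
      Finset.sum_sub_distrib, Finset.smul_sum]

end Balanced

variable {A B : Fin 2 → Matrix (Fin 2) (Fin 2) ℂ} {c : ℂ}

theorem mul_transpose_of_pairOp_eq (h : pairOp A B = c • phaseGate e) (i k : Fin 2) :
    A i * (B k)ᵀ = single i k (c * phase e i k) := by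
  ext x y
  have hentry : (A i * (B k)ᵀ) x y = (c • phaseGate e) (x, y) (i, k) := congrFun₂ h (x, y) (i, k)
  rw [hentry, single_apply, Matrix.smul_apply, phaseGate, diagonal_apply]
  aesop

theorem dotProduct_of_pairOp_eq (h : pairOp A B = c • phaseGate e) (i k : Fin 2) :
    A i i ⬝ᵥ B k k = c * phase e i k :=
  (congrFun₂ (mul_transpose_of_pairOp_eq h i k) i k).trans (single_apply_same _ _ _)

theorem diagRows_mul_of_pairOp_eq (h : pairOp A B = c • phaseGate e) :
    (of fun i => A i i) * (of fun k => B k k)ᵀ = c • phase e :=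
  Matrix.ext fun i k => dotProduct_of_pairOp_eq h i k

theorem apply_eq_zero_of_pairOp_eq (hc : c ≠ 0) (he : e ≠ 1) (h : pairOp A B = c • phaseGate e)
    {i x : Fin 2} (hne : i ≠ x) : A i x = 0 ∧ B i x = 0 := by
  have hdet := congrArg det (diagRows_mul_of_pairOp_eq h)
  rw [det_mul, det_transpose, det_smul, det_phase] at hdet
  have hunit : c ^ Fintype.card (Fin 2) * (e - 1) ≠ 0 :=
    mul_ne_zero (pow_ne_zero _ hc) (sub_ne_zero.mpr he)
  rw [← hdet] at hunit
  refine ⟨eq_zero_of_mulVec_eq_zero (right_ne_zero_of_mul hunit) (funext fun k => ?_),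
    eq_zero_of_mulVec_eq_zero (left_ne_zero_of_mul hunit) (funext fun k => ?_)⟩
  · exact (dotProduct_comm _ _).trans <| (congrFun₂ (mul_transpose_of_pairOp_eq h i k) x k).trans
      (single_apply_of_row_ne hne _ _ _)
  · exact (congrFun₂ (mul_transpose_of_pairOp_eq h k i) k x).trans
      (single_apply_of_col_ne _ _ hne _)

theorem transpose_gram_mul_gram_of_pairOp_eq (h : pairOp A B = c • phaseGate e)
    (i i' k k' : Fin 2) :
    (gram A i i')ᵀ * gram B k k' = star (c * phase e i k) • vecMulVec (A i' i) (B k' k) := by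
  have hmid : (A i)ᴴᵀ * (B k)ᴴ =
      star (c * phase e i k) • vecMulVec (Pi.single i 1) (Pi.single k 1) := by
    rw [← single_eq_single_vecMulVec_single, smul_single, smul_eq_mul, mul_one, ← transpose_single,
      ← conjTranspose_single, ← mul_transpose_of_pairOp_eq h, conjTranspose_mul, transpose_mul]
    rfl
  calc (gram A i i')ᵀ * gram B k k' = (A i')ᵀ * ((A i)ᴴᵀ * (B k)ᴴ) * B k' := by
        simp only [gram, transpose_mul, Matrix.mul_assoc]
    _ = star (c * phase e i k) • vecMulVec ((A i')ᵀ *ᵥ Pi.single i 1) (Pi.single k 1 ᵥ* B k') := by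
        rw [hmid, Matrix.mul_smul, Matrix.smul_mul, mul_vecMulVec, vecMulVec_mul]
    _ = _ := by
        rw [mulVec_single_one, single_one_vecMul]
        rfl

theorem Balanced.of_pairOp_eq (he : ‖e‖ = 1) (he1 : e ≠ 1) (h : pairOp A B = c • phaseGate e) :
    Balanced e (star c * c) (gram A) (gram B) where
  offDiag i i' k k' hne := by
    rw [transpose_gram_mul_gram_of_pairOp_eq h]
    rcases eq_or_ne c 0 with rfl | hc
    · rw [zero_mul, star_zero, zero_smul]
    rcases hne with hi | hk
    · rw [(apply_eq_zero_of_pairOp_eq hc he1 h hi.symm).1, zero_vecMulVec, smul_zero]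
    · rw [(apply_eq_zero_of_pairOp_eq hc he1 h hk.symm).2, vecMulVec_zero, smul_zero]
  trace i k := by
    have hphase : star (phase e i k) * phase e i k = 1 := by
      fin_cases i <;> fin_cases k <;> simp [phase, Complex.conj_mul', he]
    rw [transpose_gram_mul_gram_of_pairOp_eq h, trace_smul, trace_vecMulVec,
      dotProduct_of_pairOp_eq h, star_mul', smul_eq_mul, mul_mul_mul_comm, hphase, mul_one]
  cross := by
    rcases eq_or_ne c 0 with rfl | hc
    · simp [Matrix.mul_sub, transpose_gram_mul_gram_of_pairOp_eq h]
    have hadj : adjugate (phase e) = !![e, -1; -1, 1] := adjugate_fin_two_of _ _ _ _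
    have hrows : (of fun i => A i i) * ((of fun k => B k k)ᵀ * adjugate (phase e)) =
        (c * (e - 1)) • 1 := by
      rw [← Matrix.mul_assoc, diagRows_mul_of_pairOp_eq h, Matrix.smul_mul, mul_adjugate,
        det_phase, smul_smul]
    have hcols := mul_eq_smul_one_comm (mul_ne_zero hc (sub_ne_zero.mpr he1)) hrows
    have hcross : (of fun i => A i i)ᵀ * adjugate (phase e) * (of fun k => B k k) =
        (c * (e - 1)) • 1 := by
      rw [← transpose_inj, transpose_smul, transpose_one, ← hcols, hadj, transpose_mul,
        transpose_mul, transpose_transpose, Matrix.mul_assoc]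
      congr 2
      ext x y
      fin_cases x <;> fin_cases y <;> rfl
    have hphase : starRingEnd ℂ e * e = 1 := by rw [Complex.conj_mul', he]; norm_num
    rw [mul_assoc, mul_smul, ← hcross, hadj]
    simp only [Matrix.mul_sub, Matrix.mul_smul, transpose_gram_mul_gram_of_pairOp_eq h]
    ext x y
    simp only [phase, of_apply, cons_val', cons_val_zero, cons_val_one, cons_val_fin_one, mul_one,
      RCLike.star_def, star_mul', Matrix.add_apply, Matrix.sub_apply, Matrix.smul_apply,
      vecMulVec_apply, smul_eq_mul, mul_apply, transpose_apply, Fin.sum_univ_two, mul_neg]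
    linear_combination starRingEnd ℂ c * A 1 1 x * B 1 1 y * hphase

end Phase

theorem mulVec_eq_zero_of_mulVec_eq_smul {m : Type*} [Fintype m] {G H : Matrix m m ℂ}
    (hG : G.PosSemidef) (hH : H.PosSemidef) {e : ℂ} (he : ‖e‖ = 1) (he1 : e ≠ 1) {x : m → ℂ}
    (h : H *ᵥ x = e • (G *ᵥ x)) : G *ᵥ x = 0 := by
  have hval : star x ⬝ᵥ (H *ᵥ x) = e * (star x ⬝ᵥ (G *ᵥ x)) := by
    rw [h, dotProduct_smul, smul_eq_mul]
  have hnorm : star x ⬝ᵥ (H *ᵥ x) = star x ⬝ᵥ (G *ᵥ x) := by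
    rw [← Complex.norm_of_nonneg' (hH.dotProduct_mulVec_nonneg x), hval, norm_mul, he, one_mul,
      Complex.norm_of_nonneg' (hG.dotProduct_mulVec_nonneg x)]
  rw [← hG.dotProduct_mulVec_zero_iff]
  rw [hnorm] at hval
  by_contra hne
  exact he1 (mul_right_cancel₀ hne (hval.symm.trans (one_mul _).symm))

namespace Balanced

variable {e w : ℂ} {P P' Q : Fin 2 → Fin 2 → Matrix (Fin 2) (Fin 2) ℂ}

theorem of_realizes {a b : ℕ} {Φ : BipartiteOp a b → BipartiteOp 2 2} (hΦ : HasLocalKraus Φ)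
    {A : Fin 2 → Matrix (Fin a) (Fin 2) ℂ} {B : Fin 2 → Matrix (Fin b) (Fin 2) ℂ}
    (he : ‖e‖ = 1) (he1 : e ≠ 1) (h : Realizes Φ (pairOp A B) (phaseGate e) w) :
    Balanced e w (gram A) (gram B) := by
  obtain ⟨κ, _, X, Y, hXY, hrun⟩ := hΦ
  obtain ⟨c, hc, rfl⟩ := h.exists_eq_smul hrun (phaseGate_conjTranspose_mul_self he)
  exact .of_sum (fun s => .of_pairOp_eq he he1 ((kronecker_mul_pairOp _ _ A B).symm.trans (hc s)))
    (sum_transpose_gram_mul_gram hXY A B)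

theorem det_ne_zero (he : ‖e‖ = 1) (he1 : e ≠ 1) (hw : w ≠ 0) (hQ : ∀ k, (Q k k).PosSemidef)
    (h : Balanced e w P Q) : (e • Q 1 1 - Q 0 0).det ≠ 0 := by
  intro hdet
  obtain ⟨x, hx, hnull⟩ := exists_mulVec_eq_zero_iff.mpr hdet
  rw [sub_mulVec, smul_mulVec, sub_eq_zero] at hnull
  have h1 := mulVec_eq_zero_of_mulVec_eq_smul (hQ 1) (hQ 0) he he1 hnull.symm
  have h0 : Q 0 0 *ᵥ x = 0 := by rw [← hnull, h1, smul_zero]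
  have hcross := congrArg (· *ᵥ x) h.cross
  simp only [add_mulVec, ← mulVec_mulVec, sub_mulVec, smul_mulVec, h0, h1, smul_zero, sub_zero,
    mulVec_zero, add_zero, one_mulVec] at hcross
  exact smul_ne_zero (mul_ne_zero hw (sub_ne_zero.mpr he1)) hx hcross.symm

theorem apply_eq_zero (h : Balanced e w P Q) (hdet : (e • Q 1 1 - Q 0 0).det ≠ 0) {i i' : Fin 2}
    (hne : i ≠ i') : P i i' = 0 := by
  have hzero : (P i i')ᵀ * (e • Q 1 1 - Q 0 0) = 0 := by
    rw [Matrix.mul_sub, Matrix.mul_smul, h.offDiag _ _ _ _ (.inl hne),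
      h.offDiag _ _ _ _ (.inl hne), smul_zero, sub_zero]
  rw [← transpose_eq_zero]
  exact ((isUnit_iff_isUnit_det _).mpr hdet.isUnit).mul_left_eq_zero.mp hzero

theorem eq_of_apply_zero_zero_eq (h : Balanced e w P Q) (h' : Balanced e w P' Q)
    (hdet : (e • Q 1 1 - Q 0 0).det ≠ 0) (h0 : P 0 0 = P' 0 0) : P = P' := by
  have h1 : P 1 1 = P' 1 1 := by
    have hcross := h.cross.trans h'.cross.symm
    rw [h0, add_right_inj] at hcross
    rw [← transpose_inj]
    exact ((isUnit_iff_isUnit_det _).mpr hdet.isUnit).mul_left_inj.mp hcross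
  ext1 i
  ext1 i'
  rcases eq_or_ne i i' with rfl | hne
  · fin_cases i
    exacts [h0, h1]
  · rw [h.apply_eq_zero hdet hne, h'.apply_eq_zero hdet hne]

theorem det_eq (he1 : e ≠ 1) (hw : w ≠ 0) (h : Balanced e w P Q) :
    (P 0 0).det = (P 1 1).det := by
  -- Multiply `h.cross` by `r * adjugate p` and take traces; the product is linear in `p`, `r`.
  let p := (P 0 0)ᵀ
  let r := (P 1 1)ᵀ
  let τ := (r * adjugate p).trace
  have hτ : r * adjugate p + p * adjugate r = τ • 1 := mul_adjugate_add_mul_adjugate r p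
  have hrpr : r * adjugate p * r = τ • r - r.det • p := by
    rw [eq_sub_of_add_eq hτ, Matrix.sub_mul, Matrix.smul_mul, Matrix.one_mul, Matrix.mul_assoc,
      adjugate_mul, Matrix.mul_smul, Matrix.mul_one]
  have hpp : r * adjugate p * p = p.det • r := by
    rw [Matrix.mul_assoc, adjugate_mul, Matrix.mul_smul, Matrix.mul_one]
  have htrace := congrArg (fun M => (r * adjugate p * M).trace) h.cross
  simp only [Matrix.mul_add, ← Matrix.mul_assoc] at htrace
  change (r * adjugate p * p * _ + r * adjugate p * r * _).trace = _ at htrace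
  rw [hrpr, hpp] at htrace
  simp only [Matrix.sub_mul, Matrix.mul_sub, Matrix.mul_smul, Matrix.smul_mul, trace_add,
    trace_sub, trace_smul, p, r, h.trace, Matrix.mul_one, smul_eq_mul, det_transpose] at htrace
  refine mul_right_cancel₀ (mul_ne_zero hw (sub_ne_zero.mpr he1)) ?_
  linear_combination htrace

end Balanced

section Resource

variable {p q : ℕ}

/-- The operator that attaches the resource `ψ` to the two input qubits. -/
def attach (ψ : EuclideanSpace ℂ (Fin p × Fin q)) :
    Matrix (Fin (2 * p) × Fin (2 * q)) (Fin 2 × Fin 2) ℂ :=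
  fun x i =>
    let α := finProdFinEquiv.symm x.1
    let β := finProdFinEquiv.symm x.2
    if (α.1, β.1) = i then ψ (α.2, β.2) else 0

/-- The operator that a party with accumulated operator `A` applies to its part of the resource
when its input qubit is in the basis state `i`. The columns of `E` are the vectors that the party
contributes to a decomposition of the resource into product vectors. -/
def inputBlock {κ : Type*} {a : ℕ} (E : Matrix (Fin p) κ ℂ) (A : Matrix (Fin a) (Fin (2 * p)) ℂ)
    (i : Fin 2) : Matrix (Fin a) κ ℂ :=
  A.submatrix id (fun x => finProdFinEquiv (i, x)) * E

theorem mul_inputBlock {κ : Type*} {a b : ℕ} (M : Matrix (Fin b) (Fin a) ℂ)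
    (E : Matrix (Fin p) κ ℂ) (A : Matrix (Fin a) (Fin (2 * p)) ℂ) (i : Fin 2) :
    M * inputBlock E A i = inputBlock E (M * A) i := by
  rw [inputBlock, ← Matrix.mul_assoc]
  rfl

theorem joint_eq_attach_mul (ρ : BipartiteOp 2 2) (ψ : EuclideanSpace ℂ (Fin p × Fin q)) :
    joint ρ ψ = attach ψ * ρ * (attach ψ)ᴴ := by
  ext x y
  simp only [joint, attach, mul_apply, conjTranspose_apply, ite_mul, zero_mul,
    Finset.sum_ite_eq, Finset.mem_univ, if_true, apply_ite star, star_zero, mul_ite, mul_zero]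
  ring

theorem branchState_eq {a b : ℕ} (ψ : EuclideanSpace ℂ (Fin p × Fin q))
    (A : Matrix (Fin a) (Fin (2 * p)) ℂ) (B : Matrix (Fin b) (Fin (2 * q)) ℂ)
    (ρ : BipartiteOp 2 2) :
    branchState ψ A B ρ = (A ⊗ₖ B) * attach ψ * ρ * ((A ⊗ₖ B) * attach ψ)ᴴ := by
  rw [branchState, joint_eq_attach_mul, mul_conj_mul_conjTranspose]

theorem Protocol.implements_iff_realizes {n : ℕ} {P : Protocol n (2 * p) (2 * q)}
    {ψ : EuclideanSpace ℂ (Fin p × Fin q)} {U : BipartiteOp 2 2} :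
    P.Implements ψ U ↔ Realizes P.run (attach ψ) U 1 := by
  simp only [Protocol.Implements, Realizes, joint_eq_attach_mul, one_smul]

theorem kronecker_mul_attach {κ : Type*} [Fintype κ] {a b : ℕ}
    {ψ : EuclideanSpace ℂ (Fin p × Fin q)} {E : Matrix (Fin p) κ ℂ} {F : Matrix (Fin q) κ ℂ}
    (hψ : ∀ k l, ψ (k, l) = ∑ j, E k j * F l j) (A : Matrix (Fin a) (Fin (2 * p)) ℂ)
    (B : Matrix (Fin b) (Fin (2 * q)) ℂ) :
    (A ⊗ₖ B) * attach ψ = pairOp (inputBlock E A) (inputBlock F B) := by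
  ext x i
  calc ((A ⊗ₖ B) * attach ψ) x i
      = ∑ k, ∑ l, A x.1 (finProdFinEquiv (i.1, k)) * B x.2 (finProdFinEquiv (i.2, l)) *
          ψ (k, l) := by
        simp only [mul_apply, Fintype.sum_prod_type, ← finProdFinEquiv.sum_comp, attach,
          Equiv.symm_apply_apply, kroneckerMap_apply, Prod.ext_iff, mul_ite, mul_zero, ite_and]
        rw [Finset.sum_eq_single i.1 (by simp +contextual) (by simp)]
        refine Finset.sum_congr rfl fun k _ => ?_
        rw [Finset.sum_eq_single i.2 (by simp +contextual) (by simp)]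
        simp only [if_true]
    _ = pairOp (inputBlock E A) (inputBlock F B) x i := by
        simp only [hψ, pairOp, inputBlock, kroneckerMap_apply, mul_apply, submatrix_apply, id,
          Finset.sum_mul_sum]
        simp only [Finset.mul_sum]
        rw [Finset.sum_comm_cycle]
        exact Finset.sum_congr rfl fun j _ => Finset.sum_congr rfl fun k _ =>
          Finset.sum_congr rfl fun l _ => mul_mul_mul_comm _ _ _ _

theorem exists_eq_sum_mul_of_schmidtNumber {r : ℕ} {ψ : EuclideanSpace ℂ (Fin p × Fin q)}
    (hψ : IsPureStateOfSchmidtNumber r ψ) :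
    ∃ (E : Matrix (Fin p) (Fin r) ℂ) (F : Matrix (Fin q) (Fin r) ℂ),
      (∃ L : Matrix (Fin r) (Fin p) ℂ, L * E = 1) ∧ (∃ L : Matrix (Fin r) (Fin q) ℂ, L * F = 1) ∧
        ∀ k l, ψ (k, l) = ∑ j, E k j * F l j := by
  obtain ⟨-, s, e, f, hs, he, hf, hsum⟩ := hψ
  have hcols {m : ℕ} {g : Fin r → EuclideanSpace ℂ (Fin m)} (hg : Orthonormal ℂ g) :
      (of fun k j => g j k)ᴴ * (of fun k j => g j k) = 1 := by
    ext i j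
    rw [one_apply, ← orthonormal_iff_ite.mp hg i j, PiLp.inner_apply, mul_apply]
    exact Finset.sum_congr rfl fun k _ => mul_comm _ _
  have hdiag : (diagonal fun j => (s j : ℂ)⁻¹) * (diagonal fun j => (s j : ℂ)) = 1 := by
    rw [diagonal_mul_diagonal, ← diagonal_one]
    exact congrArg diagonal (funext fun j =>
      inv_mul_cancel₀ (Complex.ofReal_ne_zero.mpr (hs j).ne'))
  let G : Matrix (Fin p) (Fin r) ℂ := of fun k j => e j k
  refine ⟨G * diagonal fun j => (s j : ℂ), of fun l j => f j l,
    ⟨(diagonal fun j => (s j : ℂ)⁻¹) * Gᴴ, ?_⟩, ⟨_, hcols hf⟩, fun k l => ?_⟩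
  · rw [Matrix.mul_assoc, ← Matrix.mul_assoc Gᴴ, hcols he, Matrix.one_mul, hdiag]
  · simp only [hsum, G, mul_diagonal, of_apply, mul_comm (s _ : ℂ)]

end Resource

section RandomUnitary

theorem exists_eq_vecMulVec_of_rank_eq_one {m n : Type*} [Fintype n]
    {C : Matrix m n ℂ} (hC : C.rank = 1) : ∃ u : m → ℂ, u ≠ 0 ∧ ∃ v, C = vecMulVec u v := by
  classical
  obtain ⟨⟨u, _⟩, hu, hspan⟩ := finrank_eq_one_iff'.mp hC
  choose v hv using fun j => hspan ⟨C.col j, Pi.single j 1, mulVec_single_one C j⟩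
  refine ⟨u, fun h => hu (Subtype.ext h), v, ext fun i j => ?_⟩
  rw [vecMulVec_apply, mul_comm]
  exact (congrFun (congrArg Subtype.val (hv j)) i).symm

theorem exists_eq_smul_conjTranspose_mul_self {l m n : Type*} [Fintype l] [Fintype m] [Fintype n]
    {C : Matrix m n ℂ} (hC : C.rank = 1) (M : Matrix l m ℂ) :
    ∃ c : ℂ, (M * C)ᴴ * (M * C) = c • (Cᴴ * C) := by
  obtain ⟨u, hu, v, rfl⟩ := exists_eq_vecMulVec_of_rank_eq_one hC
  refine ⟨(star (M *ᵥ u) ⬝ᵥ (M *ᵥ u)) / (star u ⬝ᵥ u), ?_⟩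
  rw [mul_vecMulVec, conjTranspose_vecMulVec, conjTranspose_vecMulVec, vecMulVec_mul_vecMulVec,
    vecMulVec_mul_vecMulVec, vecMulVec_smul, vecMulVec_smul, smul_smul, div_mul_cancel₀]
  rwa [Ne, dotProduct_star_self_eq_zero]

theorem rank_block {a p : ℕ} (A : Matrix (Fin a) (Fin (2 * p)) ℂ) (i : Fin 2) :
    (block A i).rank = (A.submatrix id fun x => finProdFinEquiv (i, x)).rank := by
  let T := A.submatrix id fun x => finProdFinEquiv (i, x)
  have hblock : block A i = CFC.sqrt (Tᴴ * T) := rfl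
  have hT : 0 ≤ Tᴴ * T := (posSemidef_conjTranspose_mul_self T).nonneg
  have hsa : (CFC.sqrt (Tᴴ * T))ᴴ = CFC.sqrt (Tᴴ * T) := (CFC.sqrt_nonneg _).isSelfAdjoint
  rw [hblock, ← rank_conjTranspose_mul_self, hsa, CFC.sqrt_mul_sqrt_self _ hT,
    rank_conjTranspose_mul_self]

theorem actsAsRandomUnitary_of_forall_eq_smul {a c r : ℕ} {d : Fin r → ℕ}
    {M : ∀ i, Matrix (Fin (d i)) (Fin a) ℂ} (hM : ∑ i, (M i)ᴴ * M i = 1)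
    {A : Matrix (Fin a) (Fin c) ℂ} (hA : A ≠ 0) {w : Fin r → ℝ} (hw : ∀ i, 0 ≤ w i)
    (h : ∀ i, (M i * A)ᴴ * (M i * A) = (w i : ℂ) • (Aᴴ * A)) : ActsAsRandomUnitary M A := by
  have hsum : ((∑ i, w i : ℝ) : ℂ) • (Aᴴ * A) = (1 : ℂ) • (Aᴴ * A) := by
    have htotal := sum_conjTranspose_mul_self_mul M A
    simpa only [hM, Matrix.mul_one, h, ← Finset.sum_smul, ← Complex.ofReal_sum, one_smul]
      using htotal
  have hsqrt (i : Fin r) (hi : w i ≠ 0) : ((√(w i) : ℝ) : ℂ) ≠ 0 :=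
    Complex.ofReal_ne_zero.mpr ((Real.sqrt_ne_zero (hw i)).mpr hi)
  have hgram : Aᴴ * A ≠ 0 := conjTranspose_mul_self_eq_zero.not.mpr hA
  refine ⟨w, fun i => (√(w i) : ℂ)⁻¹ • M i, hw,
    Complex.ofReal_injective (smul_left_injective ℂ hgram hsum), fun i => ?_, fun i hi => ?_⟩
  · rcases eq_or_ne (w i) 0 with hi | hi
    · rw [hi, Real.sqrt_zero, Complex.ofReal_zero, zero_smul, ← conjTranspose_mul_self_eq_zero,
        h, hi, Complex.ofReal_zero, zero_smul]
    · rw [Matrix.smul_mul, smul_inv_smul₀ (hsqrt i hi)]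
  · have hcancel : star (√(w i) : ℂ)⁻¹ * ((√(w i) : ℂ)⁻¹ * w i) = 1 := by
      have hsq : (w i : ℂ) = (√(w i) : ℂ) * √(w i) := by
        rw [← Complex.ofReal_mul, Real.mul_self_sqrt (hw i)]
      rw [star_inv₀, Complex.star_def, Complex.conj_ofReal, hsq,
        inv_mul_cancel_left₀ (hsqrt i hi), inv_mul_cancel₀ (hsqrt i hi)]
    rw [Matrix.smul_mul, conjTranspose_smul, Matrix.smul_mul, Matrix.mul_smul, h, smul_smul,
      smul_smul, mul_assoc, hcancel, one_smul]

theorem conjTranspose_mul_self_eq_smul_of_gram_inputBlock {κ : Type*} [Fintype κ] {a a' p : ℕ}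
    {E : Matrix (Fin p) κ ℂ} {R : Matrix κ (Fin p) ℂ} (hE : E * R = 1)
    {A : Matrix (Fin a) (Fin (2 * p)) ℂ} {A' : Matrix (Fin a') (Fin (2 * p)) ℂ} {c : ℂ}
    (h : gram (inputBlock E A') = c • gram (inputBlock E A)) : A'ᴴ * A' = c • (Aᴴ * A) := by
  have hentry {a : ℕ} (A : Matrix (Fin a) (Fin (2 * p)) ℂ) (i i' : Fin 2) (x y : Fin p) :
      (Aᴴ * A) (finProdFinEquiv (i, x)) (finProdFinEquiv (i', y)) =
        (Rᴴ * gram (inputBlock E A) i i' * R) x y := by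
    have hcancel : Rᴴ * gram (inputBlock E A) i i' * R =
        (A.submatrix id (fun x => finProdFinEquiv (i, x)) * (E * R))ᴴ *
          (A.submatrix id (fun x => finProdFinEquiv (i', x)) * (E * R)) := by
      simp only [gram, inputBlock, conjTranspose_mul, Matrix.mul_assoc]
    rw [hcancel, hE, Matrix.mul_one, Matrix.mul_one]
    rfl
  ext x y
  obtain ⟨⟨i, x⟩, rfl⟩ := finProdFinEquiv.surjective x
  obtain ⟨⟨i', y⟩, rfl⟩ := finProdFinEquiv.surjective y
  rw [Matrix.smul_apply, hentry, hentry, h, Pi.smul_apply, Pi.smul_apply, Matrix.mul_smul,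
    Matrix.smul_mul, Matrix.smul_apply]

theorem Balanced.actsAsRandomUnitary {a r : ℕ} {d : Fin r → ℕ}
    {M : ∀ i, Matrix (Fin (d i)) (Fin a) ℂ} (hM : ∑ i, (M i)ᴴ * M i = 1)
    {A : Matrix (Fin a) (Fin (2 * 2)) ℂ} (hrank : (block A 0).rank = 1)
    {E : Matrix (Fin 2) (Fin 2) ℂ} (hE : IsUnit E) {e w : ℂ} (hw : 0 < w)
    {Q : Fin 2 → Fin 2 → Matrix (Fin 2) (Fin 2) ℂ} (hdet : (e • Q 1 1 - Q 0 0).det ≠ 0)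
    (h : Balanced e w (gram (inputBlock E A)) Q)
    (hMA : ∀ i, ∃ v, 0 ≤ v ∧ Balanced e v (gram (inputBlock E (M i * A))) Q) :
    ActsAsRandomUnitary M A := by
  have hrankE : (inputBlock E A 0).rank = 1 := by
    rwa [inputBlock, rank_mul_eq_left_of_isUnit_det _ _ ((isUnit_iff_isUnit_det E).mp hE),
      ← rank_block]
  have hgram (i : Fin r) : ∃ c : ℝ, 0 ≤ c ∧
      gram (inputBlock E (M i * A)) = (c : ℂ) • gram (inputBlock E A) := by
    obtain ⟨v, hv, hbal⟩ := hMA i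
    obtain ⟨c, hc⟩ := exists_eq_smul_conjTranspose_mul_self hrankE (M i)
    rw [mul_inputBlock] at hc
    change gram (inputBlock E (M i * A)) 0 0 = c • gram (inputBlock E A) 0 0 at hc
    have hcw : v = c * w := by
      rw [← hbal.trace 0 0, ← h.trace 0 0, hc, transpose_smul, Matrix.smul_mul, trace_smul,
        smul_eq_mul]
    have hcpos : 0 ≤ c := by
      rw [← mul_inv_cancel_right₀ hw.ne' c, ← hcw]
      exact mul_nonneg hv (RCLike.inv_pos_of_pos hw).le
    refine ⟨‖c‖, norm_nonneg c, ?_⟩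
    rw [← Complex.eq_coe_norm_of_nonneg hcpos]
    exact eq_of_apply_zero_zero_eq (hcw ▸ hbal) (h.smul c) hdet hc
  choose c hc hcA using hgram
  refine actsAsRandomUnitary_of_forall_eq_smul hM ?_ hc fun i =>
    conjTranspose_mul_self_eq_smul_of_gram_inputBlock (R := E⁻¹) ?_ (hcA i)
  · rintro rfl
    rw [rank_block, submatrix_zero, Pi.zero_apply, Pi.zero_apply, rank_zero] at hrank
    exact zero_ne_one hrank
  · exact mul_nonsing_inv E ((isUnit_iff_isUnit_det E).mp hE)

end RandomUnitary

/-- Two vectors `z 0`, `z 1` with equal squared norms `W` for both forms `H 0`, `H 1`, whose inner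
products for these forms differ by the phase `e`. If Bob's blocks have the Gram matrices `H` and
Alice projects her half of the resource on `z i` when her input is in the basis state `i`, then
what remains can be finished by Bob and Alice alone. -/
structure MatchedPair (e W : ℂ) (H : Fin 2 → Matrix (Fin 2) (Fin 2) ℂ)
    (z : Fin 2 → Fin 2 → ℂ) : Prop where
  norm_eq : ∀ i k, star (z i) ⬝ᵥ (H k *ᵥ z i) = W
  inner_eq : star (z 0) ⬝ᵥ (H 1 *ᵥ z 1) = e * (star (z 0) ⬝ᵥ (H 0 *ᵥ z 1))

theorem sub_mul_adjugate_left_mul_sub {R : Type*} [CommRing R] {G H : Matrix (Fin 2) (Fin 2) R}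
    (hdet : G.det = H.det) {e e' : R} (he : e * e' = 1) :
    (e • G - H) * adjugate G * (e' • G - H) = -(e' * (e • H - G).det) • H := by
  rw [det_fin_two, det_fin_two] at hdet
  ext i j
  fin_cases i <;> fin_cases j <;>
    simp only [adjugate_fin_two, det_fin_two, mul_apply, Fin.sum_univ_two, Matrix.sub_apply,
      Matrix.smul_apply, smul_eq_mul, of_apply, cons_val', cons_val_zero, cons_val_one,
      cons_val_fin_one, Fin.zero_eta, Fin.mk_one] <;>
    grind

theorem sub_mul_adjugate_right_mul_sub {R : Type*} [CommRing R] {G H : Matrix (Fin 2) (Fin 2) R}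
    (hdet : G.det = H.det) {e e' : R} (he : e * e' = 1) :
    (e • G - H) * adjugate H * (e' • G - H) = -(e' * (e • H - G).det) • G := by
  rw [det_fin_two, det_fin_two] at hdet
  ext i j
  fin_cases i <;> fin_cases j <;>
    simp only [adjugate_fin_two, det_fin_two, mul_apply, Fin.sum_univ_two, Matrix.sub_apply,
      Matrix.smul_apply, smul_eq_mul, of_apply, cons_val', cons_val_zero, cons_val_one,
      cons_val_fin_one, Fin.zero_eta, Fin.mk_one] <;>
    grind

theorem eq_zero_of_star_dotProduct_mulVec_eq_zero {e : ℂ}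
    {H : Fin 2 → Matrix (Fin 2) (Fin 2) ℂ} (hH : ∀ k, (H k).PosSemidef)
    (hdet : (e • H 1 - H 0).det ≠ 0) {x : Fin 2 → ℂ}
    (hx : ∀ k, star x ⬝ᵥ (H k *ᵥ x) = 0) : x = 0 := by
  have hnull (k : Fin 2) : H k *ᵥ x = 0 := ((hH k).dotProduct_mulVec_zero_iff x).mp (hx k)
  refine eq_zero_of_mulVec_eq_zero hdet ?_
  rw [sub_mulVec, smul_mulVec, hnull, hnull, smul_zero, sub_zero]

theorem perp_dotProduct (v : Fin 2 → ℂ) : star v ⬝ᵥ perp v = 0 := by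
  simp only [perp, vec2_dotProduct, Pi.star_apply, cons_val_zero, cons_val_one]
  ring

theorem star_mulVec_sub_of_isHermitian {H : Fin 2 → Matrix (Fin 2) (Fin 2) ℂ}
    (hH : ∀ k, (H k).IsHermitian) (e : ℂ) (x : Fin 2 → ℂ) :
    star ((star e • H 0 - H 1) *ᵥ x) = star x ᵥ* (e • H 0 - H 1) := by
  rw [star_mulVec, conjTranspose_sub, conjTranspose_smul, star_star, (hH 0).eq, (hH 1).eq]

theorem star_perp_dotProduct_mulVec_perp_of_det_eq {H : Fin 2 → Matrix (Fin 2) (Fin 2) ℂ}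
    (hH : ∀ k, (H k).IsHermitian) {e W : ℂ} (he : ‖e‖ = 1) (hdet : (H 0).det = (H 1).det)
    {x : Fin 2 → ℂ} (hx : ∀ k, star x ⬝ᵥ (H k *ᵥ x) = W) (k : Fin 2) :
    star (perp ((star e • H 0 - H 1) *ᵥ x)) ⬝ᵥ (H k *ᵥ perp ((star e • H 0 - H 1) *ᵥ x)) =
      -(star e * (e • H 1 - H 0).det) * W := by
  have he' : e * star e = 1 := by rw [Complex.star_def, Complex.mul_conj', he]; norm_num
  rw [star_perp_dotProduct_mulVec_perp, star_mulVec_sub_of_isHermitian hH, ← dotProduct_mulVec,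
    mulVec_mulVec, mulVec_mulVec]
  fin_cases k
  · rw [Fin.zero_eta, sub_mul_adjugate_left_mul_sub hdet he', smul_mulVec, dotProduct_smul, hx,
      smul_eq_mul]
  · rw [Fin.mk_one, sub_mul_adjugate_right_mul_sub hdet he', smul_mulVec, dotProduct_smul, hx,
      smul_eq_mul]

namespace MatchedPair

variable {e W : ℂ} {H : Fin 2 → Matrix (Fin 2) (Fin 2) ℂ} {z : Fin 2 → Fin 2 → ℂ}

theorem zero (e : ℂ) (H : Fin 2 → Matrix (Fin 2) (Fin 2) ℂ) : MatchedPair e 0 H 0 where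
  norm_eq i k := by rw [Pi.zero_apply, mulVec_zero, dotProduct_zero]
  inner_eq := by rw [Pi.zero_apply, Pi.zero_apply, mulVec_zero, mulVec_zero, dotProduct_zero,
    mul_zero]

theorem exists_of_dotProduct_eq (hH : ∀ k, (H k).PosSemidef) (he : ‖e‖ = 1)
    (hdet : (e • H 1 - H 0).det ≠ 0) (hdetH : (H 0).det = (H 1).det) {x : Fin 2 → ℂ}
    (hx : ∀ k, star x ⬝ᵥ (H k *ᵥ x) = W) : ∃ y, MatchedPair e W H ![x, y] := by
  rcases eq_or_ne W 0 with rfl | hW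
  · refine ⟨0, ?_⟩
    rw [eq_zero_of_star_dotProduct_mulVec_eq_zero hH hdet hx]
    convert zero e H
    exact cons_eq_zero_iff.mpr ⟨rfl, cons_eq_zero_iff.mpr ⟨rfl, zero_empty.symm⟩⟩
  let u := (star e • H 0 - H 1) *ᵥ x
  let κ := -(star e * (e • H 1 - H 0).det)
  have hform (k : Fin 2) : star (perp u) ⬝ᵥ (H k *ᵥ perp u) = κ * W :=
    star_perp_dotProduct_mulVec_perp_of_det_eq (fun k => (hH k).1) he hdetH hx k
  have he0 : star e ≠ 0 := star_ne_zero.mpr (norm_ne_zero_iff.mp (he ▸ one_ne_zero))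
  have hκ0 : κ ≠ 0 := neg_ne_zero.mpr (mul_ne_zero he0 hdet)
  have hκ : 0 < κ := by
    have hWpos : 0 < W := ((hx 0).symm ▸ (hH 0).dotProduct_mulVec_nonneg x).lt_of_ne' hW
    have hκW : 0 ≤ κ * W := (hform 0).symm ▸ (hH 0).dotProduct_mulVec_nonneg (perp u)
    rw [← mul_inv_cancel_right₀ hW κ]
    exact mul_pos (hκW.lt_of_ne' (mul_ne_zero hκ0 hW)) (RCLike.inv_pos_of_pos hWpos)
  obtain ⟨r, hr⟩ := CStarAlgebra.nonneg_iff_eq_star_mul_self.mp (RCLike.inv_pos_of_pos hκ).le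
  have horth : star x ⬝ᵥ ((e • H 0 - H 1) *ᵥ perp u) = 0 := by
    rw [dotProduct_mulVec, ← star_mulVec_sub_of_isHermitian fun k => (hH k).1, perp_dotProduct]
  rw [sub_mulVec, smul_mulVec, dotProduct_sub, dotProduct_smul, smul_eq_mul, sub_eq_zero] at horth
  refine ⟨r • perp u, ⟨fun i k => ?_, ?_⟩⟩
  · fin_cases i
    · exact hx k
    · change star (r • perp u) ⬝ᵥ (H k *ᵥ (r • perp u)) = W
      rw [mulVec_smul, star_smul, smul_dotProduct, dotProduct_smul, hform, smul_eq_mul,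
        smul_eq_mul, ← mul_assoc, ← hr, inv_mul_cancel_left₀ hκ0]
  · change star x ⬝ᵥ (H 1 *ᵥ (r • perp u)) = e * (star x ⬝ᵥ (H 0 *ᵥ (r • perp u)))
    rw [mulVec_smul, mulVec_smul, dotProduct_smul, dotProduct_smul, ← horth, smul_eq_mul,
      smul_eq_mul, mul_left_comm]

theorem inner_eq_swap (he : ‖e‖ = 1) (hH : ∀ k, (H k).IsHermitian) (h : MatchedPair e W H z) :
    star (z 1) ⬝ᵥ (H 0 *ᵥ z 0) = e * (star (z 1) ⬝ᵥ (H 1 *ᵥ z 0)) := by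
  have hstar (k : Fin 2) : star (star (z 0) ⬝ᵥ (H k *ᵥ z 1)) = star (z 1) ⬝ᵥ (H k *ᵥ z 0) := by
    rw [star_dotProduct, star_star, dotProduct_comm, star_mulVec, (hH k).eq, dotProduct_mulVec,
      dotProduct_comm]
  rw [← hstar, ← hstar, h.inner_eq, star_mul', ← mul_assoc, Complex.star_def, Complex.mul_conj',
    he, Complex.ofReal_one, one_pow, one_mul]

theorem cross (hH : ∀ k, (H k).PosSemidef) (he : ‖e‖ = 1) (he1 : e ≠ 1)
    (hdet : (e • H 1 - H 0).det ≠ 0) (h : MatchedPair e W H z) :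
    vecMulVec (z 0) (star (z 0)) * (e • H 0 - H 1) +
      vecMulVec (z 1) (star (z 1)) * (e • H 1 - H 0) = (W * (e - 1)) • 1 := by
  rcases eq_or_ne W 0 with rfl | hW
  · have hz (i : Fin 2) : z i = 0 :=
      eq_zero_of_star_dotProduct_mulVec_eq_zero hH hdet (h.norm_eq i)
    simp only [hz, zero_vecMulVec, add_zero, zero_mul, zero_smul]
  have hinner := h.inner_eq_swap he fun k => (hH k).1
  let D : Fin 2 → Matrix (Fin 2) (Fin 2) ℂ := ![e • H 0 - H 1, e • H 1 - H 0]
  have hrows : (of fun i => star (z i) ᵥ* D i) * (of z)ᵀ = (W * (e - 1)) • 1 := by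
    have hentry (i j : Fin 2) : ((of fun i => star (z i) ᵥ* D i) * (of z)ᵀ) i j =
        star (z i) ⬝ᵥ (D i *ᵥ z j) := by
      rw [dotProduct_mulVec, mul_apply]
      rfl
    ext i j
    rw [hentry, Matrix.smul_apply, one_apply, smul_eq_mul]
    fin_cases i <;> fin_cases j <;>
      simp only [D, Fin.zero_eta, Fin.mk_one, cons_val_zero, cons_val_one, sub_mulVec, smul_mulVec,
        dotProduct_sub, dotProduct_smul, smul_eq_mul, h.norm_eq, h.inner_eq, hinner, zero_ne_one,
        one_ne_zero, if_true, if_false] <;>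
      ring
  rw [← mul_eq_smul_one_comm (mul_ne_zero hW (sub_ne_zero.mpr he1)) hrows]
  ext x y
  simp only [vecMulVec_mul, Matrix.add_apply, vecMulVec_apply, mul_apply, Fin.sum_univ_two,
    transpose_apply, of_apply]
  rfl

end MatchedPair

theorem Balanced.exists_matchedPair {e w : ℂ} {P Q : Fin 2 → Fin 2 → Matrix (Fin 2) (Fin 2) ℂ}
    (hP : ∀ i, (P i i).PosSemidef) (hQ : ∀ k, (Q k k).PosSemidef) (he : ‖e‖ = 1) (he1 : e ≠ 1)
    (hw : w ≠ 0) (h : Balanced e w P Q) :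
    ∃ (W : Fin 2 → ℂ) (z : Fin 2 → Fin 2 → Fin 2 → ℂ),
      (∀ j, MatchedPair e (W j) (fun k => Q k k) (z j)) ∧
        ∀ i, ∑ j, vecMulVec (star (z j i)) (z j i) = P i i := by
  have hdet := h.det_ne_zero he he1 hw hQ
  obtain ⟨x, hx, hneutral⟩ := exists_sum_vecMulVec_star_eq (G := (P 0 0)ᵀ) (H := Q 0 0 - Q 1 1)
    (hP 0).transpose ((hQ 0).1.sub (hQ 1).1)
    (by rw [trace_mul_comm, Matrix.mul_sub, trace_sub, h.trace, h.trace, sub_self])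
  obtain ⟨W, hW⟩ : ∃ W : Fin 2 → ℂ, ∀ j k, star (x j) ⬝ᵥ (Q k k *ᵥ x j) = W j := by
    refine ⟨fun j => star (x j) ⬝ᵥ (Q 0 0 *ᵥ x j), fun j => Fin.forall_fin_two.mpr ⟨rfl, ?_⟩⟩
    rw [← sub_eq_zero, ← neg_eq_zero, neg_sub, ← dotProduct_sub, ← sub_mulVec, hneutral j]
  have hpair (j : Fin 2) := MatchedPair.exists_of_dotProduct_eq (H := fun k => Q k k)
    hQ he hdet (h.symm.det_eq he1 hw) (hW j)
  choose y hy using hpair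
  have hWsum : ∑ j, W j = w := by
    rw [← h.trace 0 0, ← hx, Matrix.sum_mul, trace_sum]
    refine Finset.sum_congr rfl fun j _ => ?_
    rw [← hW j 0, vecMulVec_mul, trace_vecMulVec, dotProduct_mulVec, dotProduct_comm]
  have hy_sum : ∑ j, vecMulVec (y j) (star (y j)) = (P 1 1)ᵀ := by
    have hcross : ∑ j, vecMulVec (x j) (star (x j)) * (e • Q 0 0 - Q 1 1) +
        ∑ j, vecMulVec (y j) (star (y j)) * (e • Q 1 1 - Q 0 0) = (w * (e - 1)) • 1 := by
      rw [← Finset.sum_add_distrib, ← hWsum, Finset.sum_mul, Finset.sum_smul]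
      refine Finset.sum_congr rfl fun j _ => ?_
      simpa only [cons_val_zero, cons_val_one] using (hy j).cross hQ he he1 hdet
    rw [← h.cross, ← Matrix.sum_mul, ← Matrix.sum_mul, hx, add_right_inj] at hcross
    exact ((isUnit_iff_isUnit_det _).mpr hdet.isUnit).mul_left_inj.mp hcross
  refine ⟨W, fun j => ![x j, y j], hy, fun i => ?_⟩
  rw [← transpose_inj, transpose_sum]
  simp only [transpose_vecMulVec]
  fin_cases i
  exacts [hx, hy_sum]

section RealizableBy

variable {a b : ℕ} {ι : Type*} [Fintype ι] {t : List Party}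
  {V : Matrix (Fin a × Fin b) (Fin 2 × Fin 2) ℂ} {U : BipartiteOp 2 2}

/-- After the preparation `V`, some protocol in which the parties act in the order `t` performs
`U`, up to a probability. -/
def RealizableBy (t : List Party) (V : Matrix (Fin a × Fin b) (Fin 2 × Fin 2) ℂ)
    (U : BipartiteOp 2 2) : Prop :=
  ∃ P : Protocol t.length a b, P.Follows t ∧ ∃ w, Realizes P.run V U w

theorem RealizableBy.nil (c : ℂ) (U : BipartiteOp 2 2) : RealizableBy [] (c • U) U :=
  ⟨.done, rfl, c * star c, fun ρ _ => by
    simp only [Protocol.run, conjTranspose_smul, Matrix.smul_mul, Matrix.mul_smul, smul_smul,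
      mul_comm]⟩

theorem RealizableBy.alice {d : ℕ} {M : ι → Matrix (Fin d) (Fin a) ℂ}
    (hM : ∑ s, (M s)ᴴ * M s = 1)
    (h : ∀ s, RealizableBy t ((M s ⊗ₖ (1 : Matrix (Fin b) (Fin b) ℂ)) * V) U) :
    RealizableBy (.alice :: t) V U := by
  let σ := (Fintype.equivFin ι).symm
  choose P hP w hw using fun i => h (σ i)
  refine ⟨.alice _ (fun _ => d) (fun i => M (σ i))
    ((σ.sum_comp fun s => (M s)ᴴ * M s).trans hM) P, ⟨t, rfl, hP⟩, ∑ i, w i, fun ρ hρ => ?_⟩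
  simp only [Protocol.run, mul_conj_mul_conjTranspose, Finset.sum_smul]
  exact Finset.sum_congr rfl fun i _ => hw i ρ hρ

theorem RealizableBy.bob {d : ℕ} {K : ι → Matrix (Fin d) (Fin b) ℂ}
    (hK : ∑ s, (K s)ᴴ * K s = 1)
    (h : ∀ s, RealizableBy t (((1 : Matrix (Fin a) (Fin a) ℂ) ⊗ₖ K s) * V) U) :
    RealizableBy (.bob :: t) V U := by
  let σ := (Fintype.equivFin ι).symm
  choose P hP w hw using fun i => h (σ i)
  refine ⟨.bob _ (fun _ => d) (fun i => K (σ i))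
    ((σ.sum_comp fun s => (K s)ᴴ * K s).trans hK) P, ⟨t, rfl, hP⟩, ∑ i, w i, fun ρ hρ => ?_⟩
  simp only [Protocol.run, mul_conj_mul_conjTranspose, Finset.sum_smul]
  exact Finset.sum_congr rfl fun i _ => hw i ρ hρ

theorem realizableBy_alice_phase (c : ℂ) {μ e : ℂ} (hμ : ‖μ‖ = 1) :
    RealizableBy [.alice] (diagonal fun x => (c • ![1, μ]) x.1 * phase e x.1 x.2)
      (phaseGate e) := by
  have hunit : (diagonal ![1, μ])ᴴ * diagonal ![1, μ] = (1 : Matrix (Fin 2) (Fin 2) ℂ) := by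
    rw [diagonal_conjTranspose, diagonal_mul_diagonal, diagonal_eq_one]
    refine funext (Fin.forall_fin_two.mpr ⟨?_, ?_⟩)
    · simp
    · simp [Complex.conj_mul', hμ]
  have hphase : (diagonal fun x : Fin 2 × Fin 2 => (c • ![1, μ]) x.1 * phase e x.1 x.2) =
      c • ((diagonal ![1, μ] ⊗ₖ (1 : Matrix (Fin 2) (Fin 2) ℂ)) * phaseGate e) := by
    rw [phaseGate, ← diagonal_one, diagonal_kronecker_diagonal, diagonal_mul_diagonal,
      ← diagonal_smul]
    exact congrArg diagonal (funext fun x => by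
      simp only [Pi.smul_apply, smul_eq_mul, mul_one, mul_assoc])
  refine .alice (ι := Unit) (M := fun _ => (diagonal ![1, μ])ᴴ) ?_ fun _ => ?_
  · rw [Fintype.sum_unique, conjTranspose_conjTranspose]
    exact mul_eq_one_comm.mp hunit
  · rw [hphase, Matrix.mul_smul, ← Matrix.mul_assoc, ← mul_kronecker_mul, hunit, Matrix.one_mul,
      one_kronecker_one, Matrix.one_mul]
    exact .nil c _

end RealizableBy

section ThreeTurns

/-- The blocks of the operation that keeps the input qubit and projects the resource on the
conjugate of `z i` when the input is in the basis state `i`. -/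
def rowOp {κ : Type*} (z : Fin 2 → κ → ℂ) (i : Fin 2) : Matrix (Fin 2) κ ℂ :=
  vecMulVec (Pi.single i 1) (z i)

theorem gram_rowOp {κ : Type*} (z : Fin 2 → κ → ℂ) (i i' : Fin 2) :
    gram (rowOp z) i i' = if i = i' then vecMulVec (star (z i)) (z i') else 0 := by
  rw [gram, rowOp, rowOp, conjTranspose_vecMulVec, vecMulVec_mul_vecMulVec, Pi.star_single,
    star_one, single_one_dotProduct, Pi.single_apply]
  split_ifs <;> simp

theorem gram_mul_transpose_apply {n κ : Type*} [Fintype n] [Fintype κ] (B : Fin 2 → Matrix n κ ℂ)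
    (z : Fin 2 → κ → ℂ) (k k' i i' : Fin 2) :
    gram (fun k => B k * (of z)ᵀ) k k' i i' = star (z i) ⬝ᵥ (gram B k k' *ᵥ z i') := by
  rw [gram, conjTranspose_mul, Matrix.mul_assoc, ← Matrix.mul_assoc (B k)ᴴ, ← Matrix.mul_assoc,
    dotProduct_mulVec]
  rfl

theorem pairOp_rowOp_rowOp {κ : Type*} [Fintype κ] (y z : Fin 2 → κ → ℂ) :
    pairOp (rowOp y) (rowOp z) = diagonal fun x => y x.1 ⬝ᵥ z x.2 := by
  ext ⟨s, t⟩ ⟨i, k⟩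
  simp only [pairOp, rowOp, kroneckerMap_apply, vecMulVec_apply, diagonal_apply, Pi.single_apply,
    Prod.mk.injEq, dotProduct]
  by_cases hs : s = i <;> by_cases ht : t = k <;> simp [hs, ht]

theorem pairOp_rowOp {n κ : Type*} [Fintype κ] (z : Fin 2 → κ → ℂ) (B : Fin 2 → Matrix n κ ℂ) :
    pairOp (rowOp z) B = pairOp (rowOp fun i => Pi.single i 1) fun k => B k * (of z)ᵀ := by
  ext x i
  simp only [pairOp, rowOp, kroneckerMap_apply, vecMulVec_apply, mul_assoc, ← Finset.mul_sum]
  congr 1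
  exact (dotProduct_comm (z i.1) (B i.2 x.2)).trans
    (single_one_dotProduct i.1 ((B i.2 * (of z)ᵀ) x.2)).symm

theorem exists_measurement_rowOp {ι : Type*} [Fintype ι] {a : ℕ} {κ : Type*} [Finite κ]
    {A : Fin 2 → Matrix (Fin a) κ ℂ} {z : ι → Fin 2 → κ → ℂ}
    (hoff : ∀ i i', i ≠ i' → gram A i i' = 0)
    (h : ∀ i, ∑ j, vecMulVec (star (z j i)) (z j i) = gram A i i) :
    ∃ M : ι ⊕ Fin a → Matrix (Fin 2) (Fin a) ℂ, ∑ s, (M s)ᴴ * M s = 1 ∧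
      ∀ s i, M s * A i = rowOp (Sum.elim z 0 s) i := by
  let blocks {m : ℕ} (A : Fin 2 → Matrix (Fin m) κ ℂ) : Matrix (Fin m) (Fin 2 × κ) ℂ :=
    fun x i => A i.1 x i.2
  have hgram : ∑ j, (blocks (rowOp (z j)))ᴴ * blocks (rowOp (z j)) = (blocks A)ᴴ * blocks A := by
    have hblock (i i' : Fin 2) : ∑ j, gram (rowOp (z j)) i i' = gram A i i' := by
      rcases eq_or_ne i i' with rfl | hne
      · simp only [gram_rowOp, if_true, h]
      · simp only [gram_rowOp, if_neg hne, Finset.sum_const_zero, hoff i i' hne]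
    ext x y
    have hentry := congrFun₂ (hblock x.1 y.1) x.2 y.2
    rw [Matrix.sum_apply] at hentry ⊢
    exact hentry
  obtain ⟨M, hM, hinl, hinr⟩ := exists_measurement_extending hgram
  refine ⟨M, hM, fun s i => Matrix.ext fun x j => ?_⟩
  cases s with
  | inl s => exact congrFun₂ (hinl s) x (i, j)
  | inr s =>
    have hzero : rowOp (0 : Fin 2 → κ → ℂ) i = 0 :=
      Matrix.ext fun _ _ => mul_zero _
    exact (congrFun₂ (hinr s) x (i, j)).trans (congrFun₂ hzero x j).symm

namespace MatchedPair

variable {a b : ℕ} {e W : ℂ}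

theorem dotProduct_mulVec_eq {H : Fin 2 → Matrix (Fin 2) (Fin 2) ℂ} {z : Fin 2 → Fin 2 → ℂ}
    (he : ‖e‖ = 1) (hH : ∀ k, (H k).IsHermitian) (hz : MatchedPair e W H z) (i i' k : Fin 2) :
    star (z i) ⬝ᵥ (H k *ᵥ z i') =
      star (phase e i k) * phase e i' k * (star (z i) ⬝ᵥ (H 0 *ᵥ z i')) := by
  have he' : star e * e = 1 := by rw [Complex.star_def, Complex.conj_mul', he]; norm_num
  have hinner : star (z 1) ⬝ᵥ (H 1 *ᵥ z 0) = star e * (star (z 1) ⬝ᵥ (H 0 *ᵥ z 0)) := by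
    rw [hz.inner_eq_swap he hH, ← mul_assoc, he', one_mul]
  fin_cases k <;> fin_cases i <;> fin_cases i' <;>
    simp only [phase, Fin.zero_eta, Fin.mk_one, of_apply, cons_val_zero, cons_val_one, hz.norm_eq,
      hz.inner_eq, hinner, he', star_one, one_mul, mul_one]

theorem realizableBy {B : Fin 2 → Matrix (Fin b) (Fin 2) ℂ} {z : Fin 2 → Fin 2 → ℂ} (he : ‖e‖ = 1)
    (hoff : ∀ k k', k ≠ k' → gram B k k' = 0) (hz : MatchedPair e W (fun k => gram B k k) z) :
    RealizableBy [.bob, .alice] (pairOp (rowOp z) B) (phaseGate e) := by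
  let B' (k : Fin 2) : Matrix (Fin b) (Fin 2) ℂ := B k * (of z)ᵀ
  have hB' (k k' i i') : gram B' k k' i i' = star (z i) ⬝ᵥ (gram B k k' *ᵥ z i') :=
    gram_mul_transpose_apply B z k k' i i'
  obtain ⟨c, μ, hμ, hsum⟩ := exists_sum_phase_eq (gram_posSemidef B' 0).transpose
    (by rw [transpose_apply, transpose_apply, hB', hB', hz.norm_eq, hz.norm_eq])
  let u (m k i : Fin 2) : ℂ := (c m • ![1, μ m]) i * phase e i k
  have hoff' (k k' : Fin 2) (hne : k ≠ k') : gram B' k k' = 0 := by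
    ext i i'
    rw [hB', hoff k k' hne, zero_mulVec, dotProduct_zero, Matrix.zero_apply]
  have hu (k : Fin 2) : ∑ m, vecMulVec (star (u m k)) (u m k) = gram B' k k := by
    ext i i'
    have hentry : ∑ m, (c m • ![1, μ m]) i' * star ((c m • ![1, μ m]) i) = gram B' 0 0 i i' :=
      (Matrix.sum_apply i' i _ _).symm.trans (congrFun₂ hsum i' i)
    rw [hB', hz.dotProduct_mulVec_eq he (fun k => (gram_posSemidef B k).1), ← hB', ← hentry,
      Matrix.sum_apply, Finset.mul_sum]
    refine Finset.sum_congr rfl fun m _ => ?_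
    simp only [u, vecMulVec_apply, Pi.star_apply, star_mul']
    ring
  obtain ⟨K, hK, hrow⟩ := exists_measurement_rowOp hoff' hu
  refine .bob hK fun s => ?_
  have hbranch : ((1 : Matrix (Fin 2) (Fin 2) ℂ) ⊗ₖ K s) * pairOp (rowOp z) B =
      diagonal fun x => Sum.elim u 0 s x.2 x.1 := by
    rw [pairOp_rowOp, kronecker_mul_pairOp, funext (hrow s)]
    simp only [Matrix.one_mul]
    rw [pairOp_rowOp_rowOp]
    simp only [single_one_dotProduct]
  rw [hbranch]
  cases s with
  | inl m => exact realizableBy_alice_phase (c m) (hμ m)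
  | inr s => simpa using realizableBy_alice_phase 0 (e := e) norm_one

end MatchedPair

theorem realizableBy_zero {a b : ℕ} (e : ℂ) :
    RealizableBy [.alice, .bob, .alice] (0 : Matrix (Fin a × Fin b) (Fin 2 × Fin 2) ℂ)
      (phaseGate e) := by
  refine .alice (sum_conjTranspose_mul_self_single (0 : Fin 2)) fun _ =>
    .bob (sum_conjTranspose_mul_self_single (0 : Fin 2)) fun _ => ?_
  simpa using realizableBy_alice_phase 0 (e := e) norm_one

theorem Realizes.realizableBy {a b : ℕ} {Φ : BipartiteOp a b → BipartiteOp 2 2}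
    (hΦ : HasLocalKraus Φ) {A : Fin 2 → Matrix (Fin a) (Fin 2) ℂ}
    {B : Fin 2 → Matrix (Fin b) (Fin 2) ℂ} {e w : ℂ} (he : ‖e‖ = 1) (he1 : e ≠ 1)
    (h : Realizes Φ (pairOp A B) (phaseGate e) w) :
    RealizableBy [.alice, .bob, .alice] (pairOp A B) (phaseGate e) := by
  rcases eq_or_ne w 0 with rfl | hw
  · rw [h.eq_zero hΦ (phaseGate_conjTranspose_mul_self he)]
    exact realizableBy_zero e
  have hbal := Balanced.of_realizes hΦ he he1 h
  have hoffA (i i' : Fin 2) (hne : i ≠ i') : gram A i i' = 0 :=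
    hbal.apply_eq_zero (hbal.det_ne_zero he he1 hw (gram_posSemidef B)) hne
  have hoffB (k k' : Fin 2) (hne : k ≠ k') : gram B k k' = 0 :=
    hbal.symm.apply_eq_zero (hbal.symm.det_ne_zero he he1 hw (gram_posSemidef A)) hne
  obtain ⟨W, z, hz, hsum⟩ :=
    hbal.exists_matchedPair (gram_posSemidef A) (gram_posSemidef B) he he1 hw
  obtain ⟨M, hM, hrow⟩ := exists_measurement_rowOp hoffA hsum
  refine .alice hM fun s => ?_
  rw [kronecker_mul_pairOp, funext (hrow s)]
  simp only [Matrix.one_mul]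
  cases s with
  | inl j => exact (hz j).realizableBy he hoffB
  | inr s => exact (MatchedPair.zero e _).realizableBy he hoffB

end ThreeTurns

namespace Protocol.IsNode

section Next

variable {m n a b a' b' r : ℕ} {d : Fin r → ℕ} {P : Protocol n a' b'}
  {A : Matrix (Fin a) (Fin a') ℂ} {B : Matrix (Fin b) (Fin b') ℂ}

theorem next_of_alice {M : ∀ i, Matrix (Fin (d i)) (Fin a) ℂ} {hM : ∑ i, (M i)ᴴ * M i = 1}
    {next : ∀ i, Protocol m (d i) b} (hQ : (Protocol.alice r d M hM next).IsNode P A B)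
    (i : Fin r) : (next i).IsNode P (M i * A) B := by
  simpa only [Matrix.one_mul] using (alice i here).trans hQ

theorem next_of_bob {K : ∀ i, Matrix (Fin (d i)) (Fin b) ℂ} {hK : ∑ i, (K i)ᴴ * K i = 1}
    {next : ∀ i, Protocol m a (d i)} (hQ : (Protocol.bob r d K hK next).IsNode P A B)
    (i : Fin r) : (next i).IsNode P A (K i * B) := by
  simpa only [Matrix.one_mul] using (bob i here).trans hQ

end Next

variable {m n p q a b : ℕ} {e : ℂ} {P : Protocol n (2 * p) (2 * q)} {Q : Protocol m a b}
  {A : Matrix (Fin a) (Fin (2 * p)) ℂ} {B : Matrix (Fin b) (Fin (2 * q)) ℂ}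
  {ψ : EuclideanSpace ℂ (Fin p × Fin q)}

section Factorization

variable {κ : Type*} [Fintype κ] {E : Matrix (Fin p) κ ℂ} {F : Matrix (Fin q) κ ℂ}

theorem exists_realizes_pairOp (hQ : Q.IsNode P A B) (hψ : ∀ k l, ψ (k, l) = ∑ j, E k j * F l j)
    (he : ‖e‖ = 1) (hP : P.Implements ψ (phaseGate e)) :
    ∃ w, Realizes Q.run (pairOp (inputBlock E A) (inputBlock F B)) (phaseGate e) w := by
  rw [← kronecker_mul_attach hψ A B]
  exact hQ.exists_realizes (phaseGate_conjTranspose_mul_self he) (implements_iff_realizes.mp hP)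

end Factorization

theorem exists_balanced {E : Matrix (Fin p) (Fin 2) ℂ} {F : Matrix (Fin q) (Fin 2) ℂ}
    (hQ : Q.IsNode P A B) (hψ : ∀ k l, ψ (k, l) = ∑ j, E k j * F l j)
    (he : ‖e‖ = 1) (he1 : e ≠ 1) (hP : P.Implements ψ (phaseGate e)) :
    ∃ w, 0 ≤ w ∧ (Occurs ψ A B → w ≠ 0) ∧
      Balanced e w (gram (inputBlock E A)) (gram (inputBlock F B)) := by
  have hU := phaseGate_conjTranspose_mul_self he
  obtain ⟨w, hw⟩ := hQ.exists_realizes_pairOp hψ he hP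
  refine ⟨w, hw.weight_nonneg (hasLocalKraus_run Q) hU, ?_,
    .of_realizes (hasLocalKraus_run Q) he he1 hw⟩
  rintro ⟨ρ, -, hρ⟩ rfl
  rw [branchState_eq, kronecker_mul_attach hψ, hw.eq_zero (hasLocalKraus_run Q) hU,
    Matrix.zero_mul, Matrix.zero_mul] at hρ
  exact hρ rfl

theorem exists_alice_bob_alice (hQ : Q.IsNode P A B) (hψ : IsPureStateOfSchmidtNumber 2 ψ)
    (he : ‖e‖ = 1) (he1 : e ≠ 1) (hP : P.Implements ψ (phaseGate e)) :
    ∃ Q' : Protocol 3 a b, Q'.Follows [.alice, .bob, .alice] ∧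
      ∀ ρ, IsState ρ → Q'.run (branchState ψ A B ρ) = Q.run (branchState ψ A B ρ) := by
  obtain ⟨E, F, -, -, hEF⟩ := exists_eq_sum_mul_of_schmidtNumber hψ
  obtain ⟨w, hw⟩ := hQ.exists_realizes_pairOp hEF he hP
  obtain ⟨Q', horder, v, hv⟩ := hw.realizableBy (hasLocalKraus_run Q) he he1
  have hvw : v = w := hv.weight_eq (hasLocalKraus_run Q') (hasLocalKraus_run Q)
    (phaseGate_conjTranspose_mul_self he) hw
  refine ⟨Q', horder, fun ρ hρ => ?_⟩
  rw [branchState_eq, kronecker_mul_attach hEF, hv ρ hρ, hw ρ hρ, hvw]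

end Protocol.IsNode

theorem Protocol.IsNode.actsAsRandomUnitary_alice {m n q a b r : ℕ} {d : Fin r → ℕ} {e : ℂ}
    {P : Protocol n (2 * 2) (2 * q)} {M : ∀ i, Matrix (Fin (d i)) (Fin a) ℂ}
    {hM : ∑ i, (M i)ᴴ * M i = 1} {next : ∀ i, Protocol m (d i) b}
    {A : Matrix (Fin a) (Fin (2 * 2)) ℂ} {B : Matrix (Fin b) (Fin (2 * q)) ℂ}
    {ψ : EuclideanSpace ℂ (Fin 2 × Fin q)} (hQ : (Protocol.alice r d M hM next).IsNode P A B)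
    (hψ : IsPureStateOfSchmidtNumber 2 ψ) (he : ‖e‖ = 1) (he1 : e ≠ 1)
    (hP : P.Implements ψ (phaseGate e)) (hrank : (block A 0).rank = 1) (ho : Occurs ψ A B) :
    ActsAsRandomUnitary M A := by
  obtain ⟨E, F, ⟨L, hE⟩, -, hEF⟩ := exists_eq_sum_mul_of_schmidtNumber hψ
  obtain ⟨w, hw, hw0, hbal⟩ := hQ.exists_balanced hEF he he1 hP
  refine hbal.actsAsRandomUnitary hM hrank (.of_mul_eq_one_right L hE)
    (hw.lt_of_ne' (hw0 ho)) (hbal.det_ne_zero he he1 (hw0 ho) (gram_posSemidef _)) fun i => ?_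
  obtain ⟨v, hv, -, hbal'⟩ := (hQ.next_of_alice i).exists_balanced hEF he he1 hP
  exact ⟨v, hv, hbal'⟩

theorem Protocol.IsNode.actsAsRandomUnitary_bob {m n p a b r : ℕ} {d : Fin r → ℕ} {e : ℂ}
    {P : Protocol n (2 * p) (2 * 2)} {K : ∀ i, Matrix (Fin (d i)) (Fin b) ℂ}
    {hK : ∑ i, (K i)ᴴ * K i = 1} {next : ∀ i, Protocol m a (d i)}
    {A : Matrix (Fin a) (Fin (2 * p)) ℂ} {B : Matrix (Fin b) (Fin (2 * 2)) ℂ}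
    {ψ : EuclideanSpace ℂ (Fin p × Fin 2)} (hQ : (Protocol.bob r d K hK next).IsNode P A B)
    (hψ : IsPureStateOfSchmidtNumber 2 ψ) (he : ‖e‖ = 1) (he1 : e ≠ 1)
    (hP : P.Implements ψ (phaseGate e)) (hrank : (block B 0).rank = 1) (ho : Occurs ψ A B) :
    ActsAsRandomUnitary K B := by
  obtain ⟨E, F, -, ⟨L, hF⟩, hEF⟩ := exists_eq_sum_mul_of_schmidtNumber hψ
  obtain ⟨w, hw, hw0, hbal⟩ := hQ.exists_balanced hEF he he1 hP
  refine hbal.symm.actsAsRandomUnitary hK hrank (.of_mul_eq_one_right L hF)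
    (hw.lt_of_ne' (hw0 ho)) (hbal.symm.det_ne_zero he he1 (hw0 ho) (gram_posSemidef _)) fun i => ?_
  obtain ⟨v, hv, -, hbal'⟩ := (hQ.next_of_bob i).exists_balanced hEF he he1 hP
  exact ⟨v, hv, hbal'.symm⟩

theorem branchState_one_one {p q : ℕ} (ψ : EuclideanSpace ℂ (Fin p × Fin q))
    (ρ : BipartiteOp 2 2) : branchState ψ 1 1 ρ = joint ρ ψ := by
  rw [branchState, one_kronecker_one, Matrix.one_mul, conjTranspose_one, Matrix.mul_one]

namespace Protocol.Implements

variable {m n p q : ℕ} {ψ : EuclideanSpace ℂ (Fin p × Fin q)} {e : ℂ}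

theorem exists_sameFirst {k : ℕ} {P : Protocol n (2 * p) (2 * q)}
    (hP : P.Implements ψ (phaseGate e)) (hψ : IsPureStateOfSchmidtNumber 2 ψ)
    (he : ‖e‖ = 1) (he1 : e ≠ 1) (hk : k ≤ n) :
    ∃ P' : Protocol (3 + k) (2 * p) (2 * q),
      P'.SameFirst k P ∧ P'.Implements ψ (phaseGate e) := by
  obtain ⟨m, rfl⟩ := Nat.exists_eq_add_of_le' hk
  obtain ⟨P', hsame, hrun⟩ := Protocol.exists_sameFirst (m' := 3) k P
    (fun ρ : {ρ : BipartiteOp 2 2 // IsState ρ} => joint ρ ψ) fun Q A B hQ =>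
      let ⟨Q', _, hQ'⟩ := hQ.exists_alice_bob_alice hψ he he1 hP
      ⟨Q', fun ρ => hQ' ρ ρ.2⟩
  exact ⟨P', hsame, fun ρ hρ => (hrun ⟨ρ, hρ⟩).trans (hP ρ hρ)⟩

theorem exists_alice_bob_alice {P : Protocol n (2 * p) (2 * q)}
    (hP : P.Implements ψ (phaseGate e)) (hψ : IsPureStateOfSchmidtNumber 2 ψ)
    (he : ‖e‖ = 1) (he1 : e ≠ 1) :
    ∃ P' : Protocol 3 (2 * p) (2 * q), P'.Follows [.alice, .bob, .alice] ∧
      P'.Implements ψ (phaseGate e) := by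
  obtain ⟨P', horder, hrun⟩ := IsNode.here.exists_alice_bob_alice hψ he he1 hP
  simp only [branchState_one_one] at hrun
  exact ⟨P', horder, fun ρ hρ => (hrun ρ hρ).trans (hP ρ hρ)⟩

end Protocol.Implements

end LOCC

open LOCC in
theorem mainTheorem2_general (θ : ℝ) (hθ : Complex.exp (θ * Complex.I) ≠ 1) :
    (∀ {q : ℕ} {ψ : EuclideanSpace ℂ (Fin 2 × Fin q)}, IsPureStateOfSchmidtNumber 2 ψ →
      ∀ {n : ℕ} {P : Protocol n (2 * 2) (2 * q)}, P.Implements ψ (gate θ) →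
      ∀ {m a b r : ℕ} {d : Fin r → ℕ} {M : ∀ i, Matrix (Fin (d i)) (Fin a) ℂ}
        {hM : ∑ i, (M i)ᴴ * M i = 1} {next : ∀ i, Protocol m (d i) b}
        {A : Matrix (Fin a) (Fin (2 * 2)) ℂ} {B : Matrix (Fin b) (Fin (2 * q)) ℂ},
        (Protocol.alice r d M hM next).IsNode P A B → (block A 0).rank = 1 → Occurs ψ A B →
          ActsAsRandomUnitary M A) ∧
    (∀ {p : ℕ} {ψ : EuclideanSpace ℂ (Fin p × Fin 2)}, IsPureStateOfSchmidtNumber 2 ψ →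
      ∀ {n : ℕ} {P : Protocol n (2 * p) (2 * 2)}, P.Implements ψ (gate θ) →
      ∀ {m a b r : ℕ} {d : Fin r → ℕ} {K : ∀ i, Matrix (Fin (d i)) (Fin b) ℂ}
        {hK : ∑ i, (K i)ᴴ * K i = 1} {next : ∀ i, Protocol m a (d i)}
        {A : Matrix (Fin a) (Fin (2 * p)) ℂ} {B : Matrix (Fin b) (Fin (2 * 2)) ℂ},
        (Protocol.bob r d K hK next).IsNode P A B → (block B 0).rank = 1 → Occurs ψ A B →
          ActsAsRandomUnitary K B) ∧
    (∀ {p q : ℕ} {ψ : EuclideanSpace ℂ (Fin p × Fin q)}, IsPureStateOfSchmidtNumber 2 ψ →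
      ∀ {n : ℕ} {P : Protocol n (2 * p) (2 * q)}, P.Implements ψ (gate θ) →
        (∀ {m a b : ℕ} {Q : Protocol m a b} {A : Matrix (Fin a) (Fin (2 * p)) ℂ}
          {B : Matrix (Fin b) (Fin (2 * q)) ℂ}, Q.IsNode P A B →
            ∃ Q' : Protocol 3 a b, Q'.Follows [Party.alice, Party.bob, Party.alice] ∧
              ∀ ρ, IsState ρ → Q'.run (branchState ψ A B ρ) = Q.run (branchState ψ A B ρ)) ∧
        (∀ k ≤ n, ∃ P' : Protocol (3 + k) (2 * p) (2 * q),
          P'.SameFirst k P ∧ P'.Implements ψ (gate θ)) ∧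
        ∃ P' : Protocol 3 (2 * p) (2 * q), P'.Follows [Party.alice, Party.bob, Party.alice] ∧
          P'.Implements ψ (gate θ)) := by
  have he : ‖Complex.exp (θ * Complex.I)‖ = 1 := Complex.norm_exp_ofReal_mul_I θ
  rw [gate_eq_phaseGate]
  exact ⟨fun hψ _ _ hP _ _ _ _ _ _ _ _ _ _ hQ => hQ.actsAsRandomUnitary_alice hψ he hθ hP,
    fun hψ _ _ hP _ _ _ _ _ _ _ _ _ _ hQ => hQ.actsAsRandomUnitary_bob hψ he hθ hP,
    fun hψ _ _ hP => ⟨fun hQ => hQ.exists_alice_bob_alice hψ he hθ hP,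
      fun _ => hP.exists_sameFirst hψ he hθ, hP.exists_alice_bob_alice hψ he hθ⟩⟩

open LOCC in
theorem mainTheorem2 (θ : ℝ) (hθ : Complex.exp (θ * Complex.I) ≠ 1) :
    -- the last three turns (Bob, Alice, Bob), for a two-qubit resource
    (∀ ψ : EuclideanSpace ℂ (Fin 2 × Fin 2), IsPureStateOfSchmidtNumber 2 ψ →
      ∀ (n : ℕ) (P : Protocol n (2 * 2) (2 * 2)), P.Implements ψ (gate θ) →
      ∀ (a b r : ℕ) (d : Fin r → ℕ) (K : ∀ i, Matrix (Fin (d i)) (Fin b) ℂ)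
        (hK : ∑ i, (K i)ᴴ * K i = 1) (next : ∀ i, Protocol 2 a (d i))
        (A : Matrix (Fin a) (Fin (2 * 2)) ℂ) (B : Matrix (Fin b) (Fin (2 * 2)) ℂ),
        (Protocol.bob r d K hK next).IsNode P A B →
        (Protocol.bob r d K hK next).Follows [Party.bob, Party.alice, Party.bob] →
        ((block A 0).rank = 1 →
          ∀ (i : Fin r) (r' : ℕ) (d' : Fin r' → ℕ) (M : ∀ j, Matrix (Fin (d' j)) (Fin a) ℂ)
            (hM : ∑ j, (M j)ᴴ * M j = 1) (next' : ∀ j, Protocol 1 (d' j) (d i)),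
            next i = Protocol.alice r' d' M hM next' → Occurs ψ A (K i * B) →
              ActsAsRandomUnitary M A) ∧
        ((block B 0).rank = 1 → Occurs ψ A B → ActsAsRandomUnitary K B) ∧
        ((block A 0).rank = 2 → (block B 0).rank = 2 →
          ∃ Q : Protocol 3 a b, Q.Follows [Party.alice, Party.bob, Party.alice] ∧
            ∀ ρ, IsState ρ →
              Q.run (branchState ψ A B ρ) =
                (Protocol.bob r d K hK next).run (branchState ψ A B ρ))) ∧
    -- reduction of the number of turns, for any pure resource of Schmidt number 2
    (∀ (p q : ℕ) (ψ : EuclideanSpace ℂ (Fin p × Fin q)), IsPureStateOfSchmidtNumber 2 ψ →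
      ∀ (n : ℕ) (P : Protocol n (2 * p) (2 * q)), P.Implements ψ (gate θ) →
        (3 < n → ∃ P' : Protocol (n - 1) (2 * p) (2 * q),
          P'.SameFirst (n - 4) P ∧ P'.Implements ψ (gate θ)) ∧
        ∃ P' : Protocol 3 (2 * p) (2 * q),
          (P'.Follows [Party.alice, Party.bob, Party.alice] ∨
            P'.Follows [Party.bob, Party.alice, Party.bob]) ∧
          P'.Implements ψ (gate θ)) := by
  obtain ⟨halice, hbob, hreduce⟩ := mainTheorem2_general θ hθ
  refine ⟨fun ψ hψ n P hP a b r d K hK next A B hQ _ =>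
    ⟨fun hrank i r' d' M hM next' hnext => halice hψ hP (hnext ▸ hQ.next_of_bob i) hrank,
      hbob hψ hP hQ, fun _ _ => (hreduce hψ hP).1 hQ⟩,
    fun p q ψ hψ n P hP => ⟨fun hn => ?_, ?_⟩⟩
  · rw [show n - 1 = 3 + (n - 4) by omega]
    exact (hreduce hψ hP).2.1 (n - 4) (n.sub_le 4)
  · obtain ⟨P', horder, hP'⟩ := (hreduce hψ hP).2.2
    exact ⟨P', .inl horder, hP'⟩
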